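/- For integers $r\ge 1$ and $m\ge 2$, let $T_{r,m}$ be the Brown–Thompson group: the group of all orientation-preserving piecewise affine homeomorphisms $f$ of the circle $\mathbb R/r\mathbb Z$ for which there is a finite subdivision $0=a_0<a_1<\dots<a_p=r$ and a lift $\tilde f:\mathbb R\to\mathbb R$ of $f$ such that $\tilde f$ is affine on each $[a_i,a_{i+1}]$ with slope in $\{m^s : s\in\mathbb Z\}$, and all the $a_i$ and $\tilde f(a_i)$ lie in $\mathbb Z[1/m]=\{Nm^s : N,s\in\mathbb Z\}$. Thompson's group is $T=T_{1,2}$. The rotation number of $f\in T_{r,m}$ is $\rho(f)=\lim_{n\to\infty}\tilde f^{\,n}(0)/(rn) \bmod 1\in\mathbb S^1=\mathbb R/\mathbb Z$, where $\tilde f$ is any lift of $f$. Let $r\ge 1$ and $m\ge 2$ be integers. (1) The following are equivalent: (a) for every rational point $\theta\in\mathbb Q/\mathbb Z\subset\mathbb S^1$ there is exactly one conjugacy class of $T_{r,m}$ consisting of elements of finite order with rotation number $\theta$; (b) $m=2$. (2) If $m\ne 2$, then $T$ is not isomorphic to $T_{r,m}$. (3) If $m\neq 2$ and $r\not\equiv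 0 \pmod{m-1}$, then every group homomorphism $T\to T_{r,m}$ is trivial. -/

import Mathlib

open Filter Topology

namespace BrownThompson

/-- The set `ℤ[1/m] = {N * m ^ s : N, s ∈ ℤ}` of real numbers. -/
def mAdic (m : ℕ) : Set ℝ := {x | ∃ N s : ℤ, x = N * (m : ℝ) ^ s}

/-- The circle `ℝ / rℤ` of length `r`. -/
abbrev Circ (r : ℕ) : Type := AddCircle (r : ℝ)

/-- `F : ℝ → ℝ` is a lift to `ℝ` of the homeomorphism `f` of the circle of length `r` which is
increasing; `f` preserves the orientation iff it has such a lift. -/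
structure IsIncreasingLift (r : ℕ) (f : Circ r ≃ₜ Circ r) (F : ℝ → ℝ) : Prop where
  continuous : Continuous F
  strictMono : StrictMono F
  map_add : ∀ x : ℝ, F (x + r) = F x + r
  covers : ∀ x : ℝ, f (x : Circ r) = (F x : Circ r)

/-- `B = {0 = a₀ < a₁ < ⋯ < a_p = r}` is a finite subdivision of `[0, r]` such that `F` is affine
on each of the intervals `[a_i, a_{i+1}]`, with slope in `{m ^ s : s ∈ ℤ}`, and such that the
points `a_i` and their images lie in `ℤ[1/m]`. -/
structure IsSubdivision (r m : ℕ) (F : ℝ → ℝ) (B : Finset ℝ) : Prop where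
  zero_mem : (0 : ℝ) ∈ B
  right_mem : (r : ℝ) ∈ B
  subset_Icc : ∀ a ∈ B, a ∈ Set.Icc (0 : ℝ) r
  break_mem : ∀ a ∈ B, a ∈ mAdic m
  image_mem : ∀ a ∈ B, F a ∈ mAdic m
  affine : ∀ a ∈ B, ∀ b ∈ B, a < b → (∀ c ∈ B, ¬ (a < c ∧ c < b)) →
    ∃ (s : ℤ) (β : ℝ), ∀ x ∈ Set.Icc a b, F x = (m : ℝ) ^ s * x + β

/-- The defining property of the elements of the group `T_{r,m}`. -/
def IsElement (r m : ℕ) (f : Circ r ≃ₜ Circ r) : Prop :=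
  ∃ (F : ℝ → ℝ) (B : Finset ℝ), IsIncreasingLift r f F ∧ IsSubdivision r m F B

/-! Auxiliary facts showing that the elements of `T_{r,m}` form a group. -/

section aux

variable {r m : ℕ}

theorem mAdic_mul (hm : 2 ≤ m) {x : ℝ} (hx : x ∈ mAdic m) (t : ℤ) :
    (m : ℝ) ^ t * x ∈ mAdic m := by
  obtain ⟨N, s, rfl⟩ := hx
  have h0 : (m : ℝ) ≠ 0 := by positivity
  exact ⟨N, t + s, by rw [zpow_add₀ h0]; ring⟩

theorem mAdic_mul_iff (hm : 2 ≤ m) {x : ℝ} (t : ℤ) :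
    (m : ℝ) ^ t * x ∈ mAdic m ↔ x ∈ mAdic m := by
  refine ⟨fun h => ?_, fun h => mAdic_mul hm h t⟩
  have h0 : (m : ℝ) ≠ 0 := by positivity
  have := mAdic_mul hm h (-t)
  rwa [← mul_assoc, ← zpow_add₀ h0, neg_add_cancel, zpow_zero, one_mul] at this

theorem mAdic_add (hm : 2 ≤ m) {x y : ℝ} (hx : x ∈ mAdic m) (hy : y ∈ mAdic m) :
    x + y ∈ mAdic m := by
  obtain ⟨N, s, rfl⟩ := hx
  obtain ⟨M, t, rfl⟩ := hy
  have h0 : (m : ℝ) ≠ 0 := by positivity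
  obtain ⟨i, hi⟩ : ∃ i : ℕ, s = min s t + i := ⟨(s - min s t).toNat, by omega⟩
  obtain ⟨j, hj⟩ : ∃ j : ℕ, t = min s t + j := ⟨(t - min s t).toNat, by omega⟩
  refine ⟨N * m ^ i + M * m ^ j, min s t, ?_⟩
  have e1 : (m : ℝ) ^ s = (m : ℝ) ^ (min s t) * (m : ℝ) ^ i := by
    conv_lhs => rw [hi]
    rw [zpow_add₀ h0, zpow_natCast]
  have e2 : (m : ℝ) ^ t = (m : ℝ) ^ (min s t) * (m : ℝ) ^ j := by
    conv_lhs => rw [hj]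
    rw [zpow_add₀ h0, zpow_natCast]
  rw [e1, e2]
  push_cast
  ring

theorem mAdic_neg {x : ℝ} (hx : x ∈ mAdic m) : -x ∈ mAdic m := by
  obtain ⟨N, s, rfl⟩ := hx
  exact ⟨-N, s, by push_cast; ring⟩

theorem mAdic_int (k : ℤ) : (k : ℝ) ∈ mAdic m := ⟨k, 0, by simp⟩

theorem mAdic_add_iff (hm : 2 ≤ m) {x y : ℝ} (hy : y ∈ mAdic m) :
    x + y ∈ mAdic m ↔ x ∈ mAdic m :=
  ⟨fun h => by simpa using mAdic_add hm h (mAdic_neg hy), fun h => mAdic_add hm h hy⟩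

/-- A form of the subdivision condition on the whole line, stable under composition. -/
def Good (m : ℕ) (F : ℝ → ℝ) : Prop :=
  (∀ x, F x ∈ mAdic m ↔ x ∈ mAdic m) ∧ ∃ P : Set ℝ, P ⊆ mAdic m ∧
    (∀ x y, (P ∩ Set.Icc x y).Finite) ∧
    ∀ a b, a < b → (∀ c ∈ P, ¬ (a < c ∧ c < b)) →
      ∃ (s : ℤ) (β : ℝ), ∀ x ∈ Set.Icc a b, F x = (m : ℝ) ^ s * x + β

theorem Good.comp (hm : 2 ≤ m) {F G : ℝ → ℝ} (hG : Good m G) (hF : Good m F)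
    (hF' : StrictMono F) : Good m (G ∘ F) := by
  obtain ⟨hF1, P, hP, hPf, hPa⟩ := hF
  obtain ⟨hG1, Q, hQ, hQf, hQa⟩ := hG
  have h0 : (m : ℝ) ≠ 0 := by positivity
  refine ⟨fun x => (hG1 _).trans (hF1 x), P ∪ F ⁻¹' Q, ?_, ?_, ?_⟩
  · rintro x (hx | hx)
    · exact hP hx
    · exact (hF1 x).1 (hQ hx)
  · intro x y
    rw [Set.union_inter_distrib_right]
    refine (hPf x y).union ?_
    refine ((hQf (F x) (F y)).preimage hF'.injective.injOn).subset ?_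
    rintro z ⟨hz, hz1, hz2⟩
    exact ⟨hz, hF'.monotone hz1, hF'.monotone hz2⟩
  · intro a b hab hc
    obtain ⟨s, β, h1⟩ := hPa a b hab (fun c hcP => hc c (Or.inl hcP))
    have key : ∀ c ∈ Q, ¬ (F a < c ∧ c < F b) := by
      rintro c hcQ ⟨h2, h3⟩
      have hcont : ContinuousOn F (Set.Icc a b) := by
        refine ContinuousOn.congr (f := fun x => (m : ℝ) ^ s * x + β) (by fun_prop) ?_
        exact fun x hx => h1 x hx
      obtain ⟨x, hx, rfl⟩ := intermediate_value_Icc hab.le hcont ⟨h2.le, h3.le⟩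
      exact hc x (Or.inr hcQ) ⟨hF'.lt_iff_lt.1 h2, hF'.lt_iff_lt.1 h3⟩
    obtain ⟨t, γ, h2⟩ := hQa _ _ (hF' hab) key
    refine ⟨t + s, (m : ℝ) ^ t * β + γ, fun x hx => ?_⟩
    have hx' : F x ∈ Set.Icc (F a) (F b) := ⟨hF'.monotone hx.1, hF'.monotone hx.2⟩
    rw [Function.comp, h2 _ hx', h1 x hx, zpow_add₀ h0]
    ring

theorem Good.inv (hm : 2 ≤ m) {F G : ℝ → ℝ} (hF : Good m F) (hG : StrictMono G)
    (hFG : ∀ x, F (G x) = x) (hGF : ∀ x, G (F x) = x) : Good m G := by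
  obtain ⟨hF1, P, hP, hPf, hPa⟩ := hF
  have h0 : (m : ℝ) ≠ 0 := by positivity
  refine ⟨fun x => by rw [← hF1, hFG], F '' P, ?_, ?_, ?_⟩
  · rintro _ ⟨x, hx, rfl⟩
    exact (hF1 x).2 (hP hx)
  · intro x y
    refine ((hPf (G x) (G y)).image F).subset ?_
    rintro _ ⟨⟨z, hz, rfl⟩, hz1, hz2⟩
    refine ⟨z, ⟨hz, ?_, ?_⟩, rfl⟩
    · simpa [hGF] using hG.monotone hz1
    · simpa [hGF] using hG.monotone hz2
  · intro a b hab hc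
    obtain ⟨s, β, h1⟩ := hPa (G a) (G b) (hG hab) (by
      rintro c hcP ⟨h2, h3⟩
      refine hc (F c) ⟨c, hcP, rfl⟩ ⟨?_, ?_⟩
      · rw [← hG.lt_iff_lt, hGF]; exact h2
      · rw [← hG.lt_iff_lt, hGF]; exact h3)
    refine ⟨-s, -((m : ℝ) ^ (-s) * β), fun y hy => ?_⟩
    have h2 := h1 (G y) ⟨hG.monotone hy.1, hG.monotone hy.2⟩
    rw [hFG] at h2
    have h3 : (m : ℝ) ^ (-s) * (m : ℝ) ^ s = 1 := by
      rw [← zpow_add₀ h0, neg_add_cancel, zpow_zero]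
    calc G y = ((m : ℝ) ^ (-s) * (m : ℝ) ^ s) * G y := by rw [h3, one_mul]
      _ = (m : ℝ) ^ (-s) * y + -((m : ℝ) ^ (-s) * β) := by
        conv_rhs => rw [h2]
        ring

theorem IsSubdivision.locate {F : ℝ → ℝ} {B : Finset ℝ} (h : IsSubdivision r m F B) {x y : ℝ}
    (hx : 0 ≤ x) (hxy : x < y) (hy : y ≤ r) (hc : ∀ c ∈ B, ¬ (x < c ∧ c < y)) :
    ∃ a ∈ B, a ≤ x ∧ ∃ (s : ℤ) (β : ℝ), ∀ z ∈ Set.Icc a y, F z = (m : ℝ) ^ s * z + β := by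
  have n1 : (B.filter (· ≤ x)).Nonempty := ⟨0, by simp [h.zero_mem, hx]⟩
  have n2 : (B.filter (y ≤ ·)).Nonempty := ⟨r, by simp [h.right_mem, hy]⟩
  have ha := Finset.max'_mem _ n1
  have hb := Finset.min'_mem _ n2
  have ha' := fun c hc => Finset.le_max' (B.filter (· ≤ x)) c hc
  have hb' := fun c hc => Finset.min'_le (B.filter (y ≤ ·)) c hc
  set a := (B.filter (· ≤ x)).max' n1
  set b := (B.filter (y ≤ ·)).min' n2
  simp only [Finset.mem_filter] at ha hb ha' hb'
  obtain ⟨s, β, h1⟩ := h.affine a ha.1 b hb.1 (by linarith [ha.2, hb.2]) (by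
    rintro c hcB ⟨h2, h3⟩
    refine hc c hcB ⟨?_, ?_⟩
    · by_contra h4
      exact absurd (ha' c ⟨hcB, not_lt.1 h4⟩) (not_le.2 h2)
    · by_contra h4
      exact absurd (hb' c ⟨hcB, not_lt.1 h4⟩) (not_le.2 h3))
  exact ⟨a, ha.1, ha.2, s, β, fun z hz => h1 z ⟨hz.1, hz.2.trans hb.2⟩⟩

theorem lift_add_int {F : ℝ → ℝ} (h : ∀ x : ℝ, F (x + r) = F x + r) (k : ℤ) (x : ℝ) :
    F (x + k * r) = F x + k * r := by
  have hnat : ∀ (n : ℕ) (x : ℝ), F (x + n * r) = F x + n * r := by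
    intro n
    induction n with
    | zero => intro x; simp
    | succ n ih =>
      intro x
      have : x + ((n + 1 : ℕ) : ℝ) * r = (x + n * r) + r := by push_cast; ring
      rw [this, h, ih]
      push_cast
      ring
  obtain ⟨n, rfl | rfl⟩ := k.eq_nat_or_neg
  · simpa using hnat n x
  · have h1 := hnat n (x + ((-(n : ℤ) : ℤ) : ℝ) * r)
    have h2 : x + ((-(n : ℤ) : ℤ) : ℝ) * r + n * r = x := by push_cast; ring
    rw [h2] at h1
    push_cast at h1 ⊢
    linarith

theorem exists_shift (hr : 1 ≤ r) (x : ℝ) : ∃ k : ℤ, 0 ≤ x + k * r ∧ x + k * r < r := by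
  have h0 : (0 : ℝ) < r := by exact_mod_cast hr
  refine ⟨-⌊x / r⌋, ?_, ?_⟩
  · have := (le_div_iff₀ h0).1 (Int.floor_le (x / r))
    push_cast
    linarith
  · have := (div_lt_iff₀ h0).1 (Int.lt_floor_add_one (x / r))
    push_cast
    linarith

theorem IsSubdivision.good (hr : 1 ≤ r) (hm : 2 ≤ m) {F : ℝ → ℝ} {B : Finset ℝ}
    (hF : ∀ x : ℝ, F (x + r) = F x + r) (h : IsSubdivision r m F B) : Good m F := by
  have h0 : (0 : ℝ) < r := by exact_mod_cast hr
  have hkr : ∀ k : ℤ, (k : ℝ) * r ∈ mAdic m := fun k => by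
    have := mAdic_int (m := m) (k * r)
    push_cast at this
    exact this
  refine ⟨fun x => ?_, {x | ∃ k : ℤ, x + k * r ∈ B}, ?_, ?_, ?_⟩
  · obtain ⟨k, hk1, hk2⟩ := exists_shift hr x
    rw [← mAdic_add_iff hm (hkr k), ← lift_add_int hF, ← mAdic_add_iff (x := x) hm (hkr k)]
    generalize x + k * r = y at hk1 hk2
    have n2 : (B.filter (y < ·)).Nonempty := ⟨r, by simp [h.right_mem, hk2]⟩
    have hb := Finset.min'_mem _ n2
    have hb' := fun c hc => Finset.min'_le (B.filter (y < ·)) c hc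
    set b := (B.filter (y < ·)).min' n2
    simp only [Finset.mem_filter] at hb hb'
    obtain ⟨a, ha, hay, s, β, h1⟩ := h.locate hk1 hb.2 (h.subset_Icc b hb.1).2 (by
      rintro c hc ⟨h2, h3⟩
      exact absurd (hb' c ⟨hc, h2⟩) (not_le.2 h3))
    have e1 := h1 a ⟨le_rfl, by linarith [hb.2]⟩
    have e2 := h1 y ⟨hay, hb.2.le⟩
    have e3 : F y = (m : ℝ) ^ s * (y + -a) + F a := by rw [e1, e2]; ring
    rw [e3, mAdic_add_iff hm (h.image_mem a ha), mAdic_mul_iff hm,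
      mAdic_add_iff hm (mAdic_neg (h.break_mem a ha))]
  · rintro x ⟨k, hk⟩
    exact (mAdic_add_iff hm (hkr k)).1 (h.break_mem _ hk)
  · intro x y
    refine ((B.finite_toSet.image2 (fun (b : ℝ) (k : ℤ) => b - k * r)
      (Set.finite_Icc ⌊-y / r⌋ ⌈(r - x) / r⌉))).subset ?_
    rintro z ⟨⟨k, hk⟩, hz1, hz2⟩
    have h1 := h.subset_Icc _ hk
    refine ⟨_, hk, k, ⟨?_, ?_⟩, by ring⟩
    · have : -y / r ≤ k := by rw [div_le_iff₀ h0]; linarith [h1.1]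
      exact_mod_cast (Int.floor_le _).trans this
    · have : (k : ℝ) ≤ (r - x) / r := by rw [le_div_iff₀ h0]; linarith [h1.2]
      exact_mod_cast this.trans (Int.le_ceil _)
  · intro a b hab hc
    obtain ⟨k, hk1, hk2⟩ := exists_shift hr a
    have hb : b + k * r ≤ r := by
      by_contra h1
      refine hc (r - k * r) ⟨k, by simpa using h.right_mem⟩ ⟨?_, ?_⟩ <;> linarith
    obtain ⟨a', -, ha', s, β, h1⟩ := h.locate hk1 (show a + k * r < b + k * r by linarith) hb (by
      rintro c hcB ⟨h2, h3⟩
      refine hc (c - k * r) ⟨k, by simpa using hcB⟩ ⟨?_, ?_⟩ <;> linarith)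
    refine ⟨s, (m : ℝ) ^ s * (k * r) + β - k * r, fun x hx => ?_⟩
    have h2 := h1 (x + k * r) ⟨by linarith [hx.1], by linarith [hx.2]⟩
    rw [lift_add_int hF] at h2
    linear_combination h2

theorem Good.exists_subdivision {F : ℝ → ℝ} (h : Good m F) : ∃ B, IsSubdivision r m F B := by
  obtain ⟨h1, P, hP, hPf, hPa⟩ := h
  have hz : (0 : ℝ) ∈ mAdic m := by simpa using mAdic_int (m := m) 0
  have hrr : (r : ℝ) ∈ mAdic m := by simpa using mAdic_int (m := m) r
  have hB : ∀ x, x ∈ insert (0 : ℝ) (insert (r : ℝ) (hPf 0 r).toFinset) ↔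
      x = 0 ∨ x = r ∨ (x ∈ P ∧ 0 ≤ x ∧ x ≤ r) := by intro x; simp
  have hIcc : ∀ x ∈ insert (0 : ℝ) (insert (r : ℝ) (hPf 0 r).toFinset),
      x ∈ Set.Icc (0 : ℝ) r := by
    intro x hx
    rcases (hB x).1 hx with rfl | rfl | ⟨-, hx⟩ <;> simp_all
  have hmem : ∀ x ∈ insert (0 : ℝ) (insert (r : ℝ) (hPf 0 r).toFinset), x ∈ mAdic m := by
    intro x hx
    rcases (hB x).1 hx with rfl | rfl | ⟨hx, -⟩
    exacts [hz, hrr, hP hx]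
  refine ⟨insert 0 (insert (r : ℝ) (hPf 0 r).toFinset), (hB _).2 (by simp), (hB _).2 (by simp),
    hIcc, hmem, fun a ha => (h1 a).2 (hmem a ha), ?_⟩
  intro a ha b hb hab hc
  refine hPa a b hab fun c hcP hcc => hc c ((hB c).2 (Or.inr (Or.inr ⟨hcP, ?_, ?_⟩))) hcc
  · exact (hIcc a ha).1.trans hcc.1.le
  · exact hcc.2.le.trans (hIcc b hb).2

theorem isElement_iff (hr : 1 ≤ r) (hm : 2 ≤ m) (f : Circ r ≃ₜ Circ r) :
    IsElement r m f ↔ ∃ F : ℝ → ℝ, IsIncreasingLift r f F ∧ Good m F := by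
  constructor
  · rintro ⟨F, B, hF, hB⟩
    exact ⟨F, hF, hB.good hr hm hF.map_add⟩
  · rintro ⟨F, hF, hG⟩
    obtain ⟨B, hB⟩ := hG.exists_subdivision (r := r)
    exact ⟨F, B, hF, hB⟩

theorem IsIncreasingLift.comp {f g : Circ r ≃ₜ Circ r} {F G : ℝ → ℝ}
    (hF : IsIncreasingLift r f F) (hG : IsIncreasingLift r g G) :
    IsIncreasingLift r (f * g) (F ∘ G) where
  continuous := hF.continuous.comp hG.continuous
  strictMono := hF.strictMono.comp hG.strictMono
  map_add x := by simp [hG.map_add, hF.map_add]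
  covers x := by simp [hG.covers, hF.covers]

theorem IsIncreasingLift.exists_inv {f : Circ r ≃ₜ Circ r} {F : ℝ → ℝ}
    (hF : IsIncreasingLift r f F) :
    ∃ G : ℝ → ℝ, IsIncreasingLift r f⁻¹ G ∧ (∀ x, F (G x) = x) ∧ ∀ x, G (F x) = x := by
  have hs : Function.Surjective F := by
    intro y
    obtain ⟨x, hx⟩ := QuotientAddGroup.mk_surjective (f.symm (y : Circ r))
    have h1 : ((F x : ℝ) : Circ r) = (y : Circ r) := by
      rw [← hF.covers]
      exact (congrArg f hx).trans (f.apply_symm_apply _)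
    have h2 : ((y - F x : ℝ) : Circ r) = 0 := by rw [AddCircle.coe_sub, h1, sub_self]
    obtain ⟨k, hk⟩ := (AddCircle.coe_eq_zero_iff (r : ℝ)).1 h2
    rw [zsmul_eq_mul] at hk
    exact ⟨x + k * r, by rw [lift_add_int hF.map_add]; linarith⟩
  let e := hF.strictMono.orderIsoOfSurjective F hs
  have he : ∀ x, e x = F x := fun x => rfl
  have h1 : ∀ x, F (e.symm x) = x := fun x => e.apply_symm_apply x
  have h2 : ∀ x, e.symm (F x) = x := fun x => e.symm_apply_apply x
  refine ⟨e.symm, ⟨e.symm.continuous, e.symm.strictMono, fun x => ?_, fun x => ?_⟩, h1, h2⟩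
  · apply hF.strictMono.injective
    rw [h1, hF.map_add, h1]
  · have h3 := hF.covers (e.symm x)
    rw [h1] at h3
    rw [← h3]
    exact f.symm_apply_apply _

theorem isIncreasingLift_one : IsIncreasingLift r 1 id where
  continuous := continuous_id
  strictMono := strictMono_id
  map_add _ := rfl
  covers _ := rfl

theorem good_id : Good m id :=
  ⟨fun _ => Iff.rfl, ∅, by simp, by simp, fun _ _ _ _ => ⟨0, 0, by simp⟩⟩

end aux

end BrownThompson

open BrownThompson in
/-- The Brown-Thompson group `T_{r,m}`: the group of the orientation-preserving piecewise affine
homeomorphisms of the circle `ℝ / rℤ` whose slopes are powers of `m` and whose break points and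
their images lie in `ℤ[1/m]`. -/
def BrownThompsonT (r m : ℕ) (hr : 1 ≤ r) (hm : 2 ≤ m) :
    Subgroup (AddCircle (r : ℝ) ≃ₜ AddCircle (r : ℝ)) where
  carrier := {f | IsElement r m f}
  one_mem' := (isElement_iff hr hm _).2 ⟨id, isIncreasingLift_one, good_id⟩
  mul_mem' := by
    intro f g hf hg
    obtain ⟨F, hF, hF'⟩ := (isElement_iff hr hm _).1 hf
    obtain ⟨G, hG, hG'⟩ := (isElement_iff hr hm _).1 hg
    exact (isElement_iff hr hm _).2 ⟨F ∘ G, hF.comp hG, hF'.comp hm hG' hG.strictMono⟩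
  inv_mem' := by
    intro f hf
    obtain ⟨F, hF, hF'⟩ := (isElement_iff hr hm _).1 hf
    obtain ⟨G, hG, h1, h2⟩ := hF.exists_inv
    exact (isElement_iff hr hm _).2 ⟨G, hG, hF'.inv hm hG.strictMono h1 h2⟩

/-- Thompson's group `T = T_{1,2}`. -/
abbrev ThompsonT : Subgroup (AddCircle ((1 : ℕ) : ℝ) ≃ₜ AddCircle ((1 : ℕ) : ℝ)) :=
  BrownThompsonT 1 2 le_rfl le_rfl

/-- `θ ∈ ℝ / ℤ` is the rotation number of the orientation-preserving homeomorphism `f` of the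
circle of length `r`: for a lift `F` of `f`, the sequence `F^n(0) / (r n)` converges to a real
number whose class modulo `1` is `θ`. -/
def HasRotationNumber {r : ℕ} (f : AddCircle (r : ℝ) ≃ₜ AddCircle (r : ℝ))
    (θ : AddCircle (1 : ℝ)) : Prop :=
  ∃ (F : ℝ → ℝ) (t : ℝ), BrownThompson.IsIncreasingLift r f F ∧
    Tendsto (fun n : ℕ => F^[n] 0 / (r * n)) atTop (𝓝 t) ∧ (t : AddCircle (1 : ℝ)) = θ

/-!
The elements of `T_{r,m}` are studied through their lifts to the line, which form a group `lifts`
of piecewise affine homeomorphisms of `ℝ` commuting with the translation by `r`.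

**Torsion.** A lift of an element of finite order is a power of a root `F` of the translation by
`r`: `F ^ q = shift r` (`exists_root`). Slopes are congruent to `1` modulo `m - 1`, so lengths of
intervals with end points in `ℤ[1/m]` have well-defined classes modulo `(m - 1)ℤ[1/m]` which
elements of `lifts` preserve (`PL_sub_mem`), and conversely two such intervals with congruent
lengths are piecewise affinely homeomorphic (`exists_interval_map`). The class of `F 0` is thus a
conjugacy invariant of `F`, it satisfies `q * F 0 ≡ r`, it can be prescribed subject to that
condition (`exists_root_displacement`), and it determines `F` up to conjugacy
(`exists_conj_of_roots`). For `m = 2` this leaves exactly one class for each rotation number. For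
`m ≠ 2` and `q = m - 1` there is no root at all if `m - 1` does not divide `r`, and otherwise there
are two roots such that no power of the first is conjugate to the second
(`exists_nonconj_roots`), whereas in `T` each element of order `q` is conjugate to a power of any
given one (`exists_isConj_zpow`). This proves the first two parts.

**Homomorphisms from `T`.** If `m - 1` does not divide `r`, then `T_{r,m}` has no element of order
`m - 1`, so the kernel of a homomorphism from `T` contains an element of rotation number `1 / k` and
order `k ≥ 2`, hence all of them, as they are conjugate. A normal subgroup `N` with this property
is `T` (`normal_eq_top`). Indeed, `N` moves `0` to any other dyadic point, so `T / N` is the image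
of the stabilizer of `0`; germs of piecewise affine maps at a fixed point commute, so commutators
come from elements which are the identity near `0`; and those commute modulo `N` since `N` can make
their supports disjoint. So `T / N` is metabelian, and it remains to see that `T` is perfect.

**Perfectness.** Let `χ` be a homomorphism from `T` to a commutative group, `t n` its value at a
rotation of order `n`, and consider subdivisions of the circle into dyadic intervals. The map
from a subdivision in which one interval is halved to the one in which the next interval is halved
instead has value `t (n + 1) / t n`; halving once more gives
`t (n + 1) / t n = (t (n + 2) / t (n + 1)) ^ 2` (`IsHalving.relation`), which together with
`t n ^ n = 1` forces `t n = 1` for all `n ≥ 2` (`transported_rotation`). Consequently `χ` does not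
see which intervals are halved, and since every element of `T` maps a subdivision affinely to
another one and both can be made uniform by halvings, `χ` is trivial (`eq_one_of_commGroup`).
-/

namespace BrownThompson

variable {m : ℕ}

/-! ### Piecewise affine homeomorphisms of the line -/

/-- The translation `x ↦ x + c` of the real line. -/
def shift (c : ℝ) : ℝ ≃o ℝ := OrderIso.addRight c

@[simp] theorem shift_apply (c x : ℝ) : shift c x = x + c := rfl

theorem shift_mul (a b : ℝ) : shift a * shift b = shift (a + b) := by
  ext x; simp only [RelIso.mul_apply, shift_apply]; ring

theorem shift_zero : shift 0 = 1 := by ext x; simp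

theorem shift_inv (a : ℝ) : (shift a)⁻¹ = shift (-a) := by
  rw [inv_eq_iff_mul_eq_one, shift_mul, add_neg_cancel, shift_zero]

theorem shift_pow (c : ℝ) (k : ℕ) : shift c ^ k = shift (k * c) := by
  induction k with
  | zero => simp [shift_zero]
  | succ k ih => rw [pow_succ, ih, shift_mul]; congr 1; push_cast; ring

theorem shift_zpow (c : ℝ) (k : ℤ) : shift c ^ k = shift (k * c) := by
  obtain ⟨n, rfl | rfl⟩ := k.eq_nat_or_neg
  · simp [shift_pow]
  · simp [shift_pow, shift_inv]

theorem shift_injective : Function.Injective shift := fun a b h => by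
  have := DFunLike.congr_fun h 0
  simpa using this

theorem commute_shift_iff {e : ℝ ≃o ℝ} {c : ℝ} :
    Commute e (shift c) ↔ ∀ x, e (x + c) = e x + c :=
  ⟨fun h x => DFunLike.congr_fun h.eq x, fun h => by ext x; exact h x⟩

/-- The group of the increasing piecewise affine homeomorphisms of the line, with locally finitely
many break points, whose slopes are powers of `m` and which preserve `ℤ[1/m]`. -/
def PL (hm : 2 ≤ m) : Subgroup (ℝ ≃o ℝ) where
  carrier := {e | Good m e}
  one_mem' := good_id
  mul_mem' := by
    intro a b ha hb
    exact Good.comp (G := a) (F := b) hm ha hb b.strictMono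
  inv_mem' := fun {a} ha => Good.inv hm ha a⁻¹.strictMono (fun x => by simp) (fun x => by simp)

theorem mAdic_zero : (0 : ℝ) ∈ mAdic m := by simpa using mAdic_int (m := m) 0

theorem mAdic_sub (hm : 2 ≤ m) {x y : ℝ} (hx : x ∈ mAdic m) (hy : y ∈ mAdic m) :
    x - y ∈ mAdic m := by
  rw [sub_eq_add_neg]; exact mAdic_add hm hx (mAdic_neg hy)

theorem mAdic_int_mul {x : ℝ} (hx : x ∈ mAdic m) (k : ℤ) : k * x ∈ mAdic m := by
  obtain ⟨N, s, rfl⟩ := hx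
  exact ⟨k * N, s, by push_cast; ring⟩

theorem good_affine (hm : 2 ≤ m) (s : ℤ) {c : ℝ} (hc : c ∈ mAdic m) :
    Good m (fun x => (m : ℝ) ^ s * x + c) :=
  ⟨fun x => by rw [mAdic_add_iff hm hc, mAdic_mul_iff hm], ∅, by simp, by simp,
    fun _ _ _ _ => ⟨s, c, fun _ _ => rfl⟩⟩

theorem shift_mem_PL (hm : 2 ≤ m) {c : ℝ} (hc : c ∈ mAdic m) : shift c ∈ PL hm := by
  have := good_affine hm 0 hc
  simp only [zpow_zero, one_mul] at this
  exact this

/-- The affine bijection `x ↦ m ^ s * x + c`. -/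
noncomputable def affineIso (hm : 2 ≤ m) (s : ℤ) (c : ℝ) : ℝ ≃o ℝ :=
  shift c * OrderIso.mulLeft₀ ((m : ℝ) ^ s) (by positivity)

@[simp] theorem affineIso_apply (hm : 2 ≤ m) (s : ℤ) (c x : ℝ) :
    affineIso hm s c x = (m : ℝ) ^ s * x + c := rfl

theorem affineIso_mem (hm : 2 ≤ m) (s : ℤ) {c : ℝ} (hc : c ∈ mAdic m) :
    affineIso hm s c ∈ PL hm := good_affine hm s hc

theorem Good.glue {F F₁ F₂ : ℝ → ℝ} {a : ℝ} (ha : a ∈ mAdic m) (h₁ : Good m F₁) (h₂ : Good m F₂)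
    (e₁ : ∀ x ≤ a, F x = F₁ x) (e₂ : ∀ x, a ≤ x → F x = F₂ x) : Good m F := by
  obtain ⟨i₁, P₁, hP₁, f₁, a₁⟩ := h₁
  obtain ⟨i₂, P₂, hP₂, f₂, a₂⟩ := h₂
  refine ⟨fun x => ?_, insert a (P₁ ∩ Set.Iic a ∪ P₂ ∩ Set.Ici a), ?_, ?_, ?_⟩
  · rcases le_total x a with h | h
    · rw [e₁ x h, i₁]
    · rw [e₂ x h, i₂]
  · rintro x (rfl | ⟨hx, -⟩ | ⟨hx, -⟩)
    exacts [ha, hP₁ hx, hP₂ hx]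
  · intro x y
    refine (((f₁ x y).union (f₂ x y)).insert a).subset ?_
    rintro z ⟨rfl | ⟨hz, -⟩ | ⟨hz, -⟩, hz'⟩
    · exact Or.inl rfl
    · exact Or.inr (Or.inl ⟨hz, hz'⟩)
    · exact Or.inr (Or.inr ⟨hz, hz'⟩)
  · intro x y hxy hc
    have := hc a (Or.inl rfl)
    rcases le_or_gt y a with h | h
    · obtain ⟨s, β, h1⟩ := a₁ x y hxy fun c hcP hcc =>
        hc c (Or.inr (Or.inl ⟨hcP, hcc.2.le.trans h⟩)) hcc
      exact ⟨s, β, fun z hz => by rw [e₁ z (hz.2.trans h), h1 z hz]⟩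
    · have h' : a ≤ x := by
        by_contra h2
        exact this ⟨not_le.1 h2, h⟩
      obtain ⟨s, β, h1⟩ := a₂ x y hxy fun c hcP hcc =>
        hc c (Or.inr (Or.inr ⟨hcP, h'.trans hcc.1.le⟩)) hcc
      exact ⟨s, β, fun z hz => by rw [e₂ z (h'.trans hz.1), h1 z hz]⟩

/-- A function which coincides on each interval `[nl, (n + 1)l]` with a piecewise affine function
is piecewise affine. -/
theorem good_of_pieces {F : ℝ → ℝ} {l : ℝ} (hl : 0 < l) (hlm : l ∈ mAdic m)
    (h : ∀ n : ℤ, ∃ G, Good m G ∧ ∀ x ∈ Set.Icc (n * l) ((n + 1) * l), F x = G x) :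
    Good m F := by
  choose G hG hFG using h
  choose i P hP f a using hG
  have hfloor : ∀ x : ℝ, ⌊x / l⌋ * l ≤ x ∧ x < (⌊x / l⌋ + 1) * l := fun x =>
    ⟨(le_div_iff₀ hl).1 (Int.floor_le _), (div_lt_iff₀ hl).1 (Int.lt_floor_add_one _)⟩
  -- the end points of the intervals, and the break points of each piece inside its interval
  refine ⟨fun x => ?_, {x | ∃ n : ℤ, x = n * l ∨ (x ∈ P n ∧ n * l ≤ x ∧ x ≤ (n + 1) * l)},
    ?_, ?_, ?_⟩
  · rw [hFG _ x ⟨(hfloor x).1, (hfloor x).2.le⟩, i]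
  · rintro x ⟨n, rfl | ⟨hx, -⟩⟩
    exacts [mAdic_int_mul hlm n, hP n hx]
  · intro x y
    refine ((Set.finite_Icc (⌊x / l⌋ - 1) (⌊y / l⌋)).biUnion
      (t := fun n => insert ((n : ℝ) * l) (P n ∩ Set.Icc x y))
      fun n _ => (f n x y).insert _).subset ?_
    rintro z ⟨⟨n, hz⟩, hz'⟩
    have hnz : n * l ≤ z ∧ z ≤ (n + 1) * l := by
      rcases hz with rfl | ⟨-, hz⟩
      · exact ⟨le_rfl, by nlinarith⟩
      · exact hz
    refine Set.mem_biUnion (x := n) ⟨?_, ?_⟩ ?_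
    · have : ⌊x / l⌋ ≤ n + 1 := by
        have : (⌊x / l⌋ : ℝ) ≤ ((n + 1 : ℤ) : ℝ) := by
          push_cast
          refine (Int.floor_le _).trans ?_
          rw [div_le_iff₀ hl]
          exact hz'.1.trans hnz.2
        exact_mod_cast this
      linarith
    · exact Int.le_floor.2 ((le_div_iff₀ hl).2 (hnz.1.trans hz'.2))
    · rcases hz with rfl | ⟨hz, -⟩
      · exact Or.inl rfl
      · exact Or.inr ⟨hz, hz'⟩
  · intro x y hxy hc
    obtain ⟨h1, h2⟩ := hfloor x
    set n := ⌊x / l⌋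
    have h3 : y ≤ (n + 1) * l := by
      by_contra h3
      exact hc ((n + 1) * l) ⟨n + 1, Or.inl (by push_cast; ring)⟩ ⟨h2, not_le.1 h3⟩
    obtain ⟨s, β, h4⟩ := a n x y hxy fun c hcP hcc =>
      hc c ⟨n, Or.inr ⟨hcP, h1.trans hcc.1.le, hcc.2.le.trans h3⟩⟩ hcc
    exact ⟨s, β, fun z hz => by rw [hFG n z ⟨h1.trans hz.1, hz.2.trans h3⟩, h4 z hz]⟩

/-- Two piecewise affine homeomorphisms which agree at a point `a` of `ℤ[1/m]` can be glued
at `a`. -/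
theorem exists_glue (hm : 2 ≤ m) {e₁ e₂ : ℝ ≃o ℝ} (h₁ : e₁ ∈ PL hm) (h₂ : e₂ ∈ PL hm) {a : ℝ}
    (ha : a ∈ mAdic m) (h : e₁ a = e₂ a) :
    ∃ e ∈ PL hm, (∀ x ≤ a, e x = e₁ x) ∧ ∀ x, a ≤ x → e x = e₂ x := by
  set F : ℝ → ℝ := fun x => if x ≤ a then e₁ x else e₂ x with hF
  have E₁ : ∀ x ≤ a, F x = e₁ x := fun x hx => if_pos hx
  have E₂ : ∀ x, a ≤ x → F x = e₂ x := fun x hx => by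
    rcases hx.eq_or_lt with rfl | hx
    · rw [E₁ _ le_rfl, h]
    · exact if_neg (not_le.2 hx)
  have hmono : StrictMono F := by
    intro x y hxy
    rcases le_total y a with hy | hy
    · rw [E₁ _ hy, E₁ _ (hxy.le.trans hy)]; exact e₁.strictMono hxy
    · rcases le_total x a with hx | hx
      · rw [E₁ _ hx, E₂ _ hy]
        rcases hx.eq_or_lt with rfl | hx
        · rw [h]; exact e₂.strictMono hxy
        · exact (e₁.strictMono hx).trans_le (h ▸ e₂.monotone hy)
      · rw [E₂ _ hx, E₂ _ hy]; exact e₂.strictMono hxy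
  have hsurj : Function.Surjective F := by
    intro y
    rcases le_total y (e₁ a) with hy | hy
    · exact ⟨e₁.symm y, by rw [E₁ _ (by rwa [OrderIso.symm_apply_le]), OrderIso.apply_symm_apply]⟩
    · exact ⟨e₂.symm y, by
        rw [E₂ _ (by rwa [OrderIso.le_symm_apply, ← h]), OrderIso.apply_symm_apply]⟩
  exact ⟨hmono.orderIsoOfSurjective F hsurj, Good.glue ha h₁ h₂ E₁ E₂, E₁, E₂⟩

theorem lt_of_pow_eq_shift {B : ℝ ≃o ℝ} {q : ℕ} {c : ℝ} (hc : 0 < c) (hB : B ^ q = shift c)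
    (x : ℝ) : x < B x := by
  by_contra! h
  have key : ∀ n : ℕ, (B ^ n) x ≤ x := by
    intro n
    induction n with
    | zero => simp
    | succ n ih => rw [pow_succ, RelIso.mul_apply]; exact ((B ^ n).monotone h).trans ih
  have := key q
  rw [hB, shift_apply] at this
  linarith

theorem zpow_strictMono {B : ℝ ≃o ℝ} (h : ∀ x, x < B x) (x : ℝ) :
    StrictMono fun n : ℤ => (B ^ n) x := by
  refine strictMono_int_of_lt_succ fun n => ?_
  rw [zpow_add_one, RelIso.mul_apply]
  exact (B ^ n).strictMono (h x)

theorem exists_zpow_bracket {B : ℝ ≃o ℝ} {q : ℕ} {c : ℝ} (hc : 0 < c) (hB : B ^ q = shift c)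
    (x y : ℝ) : ∃ n : ℤ, (B ^ n) x ≤ y ∧ y < (B ^ (n + 1)) x := by
  have hlt := lt_of_pow_eq_shift hc hB
  have hmono := zpow_strictMono hlt x
  have hB' : ∀ k : ℤ, (B ^ ((q : ℤ) * k)) x = x + k * c := fun k => by
    rw [zpow_mul, zpow_natCast, hB, shift_zpow, shift_apply]
  obtain ⟨n, h1, h2⟩ := Int.exists_greatest_of_bdd (P := fun n : ℤ => (B ^ n) x ≤ y)
    ⟨q * ⌈(y - x) / c⌉, fun z hz => by
      refine hmono.le_iff_le.1 (hz.trans ?_)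
      have : (y - x) / c ≤ _ := Int.le_ceil _
      rw [div_le_iff₀ hc] at this
      simp only [hB']
      linarith⟩
    ⟨q * ⌊(y - x) / c⌋, by
      have : _ ≤ (y - x) / c := Int.floor_le _
      rw [le_div_iff₀ hc] at this
      simp only [hB']
      linarith⟩
  refine ⟨n, h1, ?_⟩
  by_contra! h3
  have := h2 _ h3
  omega

/-- A piecewise affine homeomorphism from `[0, l]` onto a fundamental domain `[H 0, B (H 0)]` of
`B` extends to a conjugacy between the translation by `l` and `B`. -/
theorem exists_equivariant (hm : 2 ≤ m) {B H : ℝ ≃o ℝ} (hBm : B ∈ PL hm) (hH : H ∈ PL hm)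
    {q : ℕ} {c : ℝ} (hc : 0 < c) (hB : B ^ q = shift c) {l : ℝ} (hl : 0 < l)
    (hlm : l ∈ mAdic m) (hHl : H l = B (H 0)) :
    ∃ Ψ ∈ PL hm, (∀ x ∈ Set.Icc 0 l, Ψ x = H x) ∧ Ψ * shift l = B * Ψ := by
  have hlt := lt_of_pow_eq_shift hc hB
  have hmono := zpow_strictMono hlt (H 0)
  -- the only possible extension: `Ψ (x + n * l) = B ^ n (H x)` for `x ∈ [0, l)`
  set F : ℝ → ℝ := fun x => (B ^ ⌊x / l⌋) (H (x - ⌊x / l⌋ * l)) with hF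
  have hfloor : ∀ x : ℝ, ⌊x / l⌋ * l ≤ x ∧ x < (⌊x / l⌋ + 1) * l := fun x =>
    ⟨(le_div_iff₀ hl).1 (Int.floor_le _), (div_lt_iff₀ hl).1 (Int.lt_floor_add_one _)⟩
  have hfl : ∀ (n : ℤ) x, n * l ≤ x → x < (n + 1) * l → ⌊x / l⌋ = n := fun n x h1 h2 =>
    Int.floor_eq_iff.2 ⟨(le_div_iff₀ hl).2 h1, (div_lt_iff₀ hl).2 h2⟩
  have hpiece : ∀ (n : ℤ), ∀ x ∈ Set.Icc (n * l) ((n + 1) * l),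
      F x = (B ^ n * H * shift (-(n * l))) x := by
    rintro n x ⟨h1, h2⟩
    rcases h2.eq_or_lt with rfl | h2
    · have : ⌊(n + 1) * l / l⌋ = n + 1 := by
        apply hfl <;> push_cast <;> nlinarith
      simp only [hF, this, RelIso.mul_apply, shift_apply]
      have e1 : (n + 1) * l - ((n + 1 : ℤ) : ℝ) * l = 0 := by push_cast; ring
      have e2 : (n + 1) * l + -(n * l) = l := by ring
      rw [e1, e2, hHl, zpow_add_one, RelIso.mul_apply]
    · simp only [hF, hfl n x h1 h2, RelIso.mul_apply, shift_apply, sub_eq_add_neg]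
  have hlow : ∀ x, (B ^ ⌊x / l⌋) (H 0) ≤ F x := fun x =>
    (B ^ ⌊x / l⌋).monotone (H.monotone (by linarith [(hfloor x).1]))
  have hup : ∀ x, F x < (B ^ (⌊x / l⌋ + 1)) (H 0) := fun x => by
    rw [zpow_add_one, RelIso.mul_apply, ← hHl]
    exact (B ^ ⌊x / l⌋).strictMono (H.strictMono (by linarith [(hfloor x).2]))
  have hFmono : StrictMono F := by
    intro x y hxy
    rcases (Int.floor_mono ((div_le_div_iff_of_pos_right hl).2 hxy.le)).eq_or_lt with h | h
    · simp only [hF, h]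
      exact (B ^ ⌊y / l⌋).strictMono (H.strictMono (by linarith))
    · exact (hup x).trans_le ((hmono.monotone (Int.add_one_le_iff.2 h)).trans (hlow y))
  have hFsurj : Function.Surjective F := by
    intro y
    obtain ⟨n, h1, h2⟩ := exists_zpow_bracket hc hB (H 0) y
    set z := H⁻¹ ((B ^ n)⁻¹ y) with hz
    have hz' : (B ^ n) (H z) = y := by simp [hz]
    have h3 : 0 ≤ z := by
      rw [← hz', (B ^ n).le_iff_le, H.le_iff_le] at h1; exact h1
    have h4 : z < l := by
      rw [zpow_add_one, RelIso.mul_apply, ← hHl, ← hz', (B ^ n).lt_iff_lt, H.lt_iff_lt] at h2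
      exact h2
    refine ⟨z + n * l, ?_⟩
    rw [hpiece n _ ⟨by linarith, by linarith⟩]
    simp [hz']
  have hgood : Good m F := good_of_pieces hl hlm fun n =>
    ⟨_, (PL hm).mul_mem ((PL hm).mul_mem ((PL hm).zpow_mem hBm n) hH)
      (shift_mem_PL hm (mAdic_neg (mAdic_int_mul hlm n))), hpiece n⟩
  refine ⟨hFmono.orderIsoOfSurjective F hFsurj, hgood, fun x hx => ?_, ?_⟩
  · have := hpiece 0 x (by simpa using hx)
    simpa using this
  · ext x
    change F (x + l) = B (F x)
    have h1 := hfloor x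
    rw [hpiece (⌊x / l⌋ + 1) (x + l) ⟨by push_cast; linarith, by push_cast; linarith⟩,
      hpiece ⌊x / l⌋ x ⟨h1.1, h1.2.le⟩]
    simp only [RelIso.mul_apply, shift_apply, add_comm ⌊x / l⌋ 1, zpow_one_add]
    congr 3
    push_cast
    ring

/-! ### Lengths modulo `m - 1` -/

/-- The subgroup `(m - 1)ℤ[1/m]` of `ℝ`. -/
def lenIdeal (hm : 2 ≤ m) : AddSubgroup ℝ where
  carrier := {x | ∃ z ∈ mAdic m, x = (m - 1) * z}
  zero_mem' := ⟨0, mAdic_zero, by simp⟩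
  add_mem' := by
    rintro _ _ ⟨x, hx, rfl⟩ ⟨y, hy, rfl⟩
    exact ⟨x + y, mAdic_add hm hx hy, by ring⟩
  neg_mem' := by
    rintro _ ⟨x, hx, rfl⟩
    exact ⟨-x, mAdic_neg hx, by ring⟩

theorem zpow_mul_sub_mem (hm : 2 ≤ m) {x : ℝ} (hx : x ∈ mAdic m) (s : ℤ) :
    (m : ℝ) ^ s * x - x ∈ lenIdeal hm := by
  have h0 : (m : ℝ) ≠ 0 := by positivity
  have key : ∀ (n : ℕ) {x : ℝ}, x ∈ mAdic m → (m : ℝ) ^ n * x - x ∈ lenIdeal hm := by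
    intro n x hx
    obtain ⟨k, hk⟩ := sub_one_dvd_pow_sub_one (m : ℤ) n
    have hk' : (m : ℝ) ^ n - 1 = (m - 1) * k := by exact_mod_cast hk
    exact ⟨k * x, mAdic_int_mul hx k, by linear_combination x * hk'⟩
  obtain ⟨n, rfl | rfl⟩ := s.eq_nat_or_neg
  · simpa using key n hx
  · have h := (lenIdeal hm).neg_mem (key n (mAdic_mul hm hx (-n)))
    rw [← mul_assoc, ← zpow_natCast, ← zpow_add₀ h0, add_neg_cancel, zpow_zero] at h
    simpa using h

/-- Elements of `PL` preserve the lengths modulo `m - 1` of the intervals with end points in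
`ℤ[1/m]`. -/
theorem PL_sub_mem {hm : 2 ≤ m} {e : ℝ ≃o ℝ} (he : e ∈ PL hm) {x y : ℝ} (hx : x ∈ mAdic m)
    (hy : y ∈ mAdic m) : (e y - y) - (e x - x) ∈ lenIdeal hm := by
  obtain ⟨-, P, hP, hf, ha⟩ := he
  have key : ∀ (n : ℕ) (x y : ℝ), x ∈ mAdic m → y ∈ mAdic m → x < y →
      (P ∩ Set.Ioo x y).ncard ≤ n → (e y - y) - (e x - x) ∈ lenIdeal hm := by
    intro n
    induction n with
    | zero =>
      intro x y hx hy hxy hn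
      have hfin : (P ∩ Set.Ioo x y).Finite := (hf x y).subset (by
        gcongr; exact Set.Ioo_subset_Icc_self)
      have hem : P ∩ Set.Ioo x y = ∅ := (Set.ncard_eq_zero hfin).1 (by omega)
      obtain ⟨s, β, h⟩ := ha x y hxy fun c hcP hcc => by
        have : c ∈ P ∩ Set.Ioo x y := ⟨hcP, hcc⟩
        rw [hem] at this
        exact this
      rw [h x ⟨le_rfl, hxy.le⟩, h y ⟨hxy.le, le_rfl⟩]
      convert zpow_mul_sub_mem hm (mAdic_sub hm hy hx) s using 1
      ring
    | succ n ih =>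
      intro x y hx hy hxy hn
      have hfin : (P ∩ Set.Ioo x y).Finite := (hf x y).subset (by
        gcongr; exact Set.Ioo_subset_Icc_self)
      rcases (P ∩ Set.Ioo x y).eq_empty_or_nonempty with hem | ⟨c, hcP, hxc, hcy⟩
      · exact ih x y hx hy hxy (by simp [hem])
      · have h1 := ih x c hx (hP hcP) hxc (by
          have : P ∩ Set.Ioo x c ⊂ P ∩ Set.Ioo x y := by
            refine ⟨fun z hz => ⟨hz.1, hz.2.1, hz.2.2.trans hcy⟩, fun h => ?_⟩
            exact lt_irrefl c (h ⟨hcP, hxc, hcy⟩).2.2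
          have := Set.ncard_lt_ncard this hfin
          omega)
        have h2 := ih c y (hP hcP) hy hcy (by
          have : P ∩ Set.Ioo c y ⊂ P ∩ Set.Ioo x y := by
            refine ⟨fun z hz => ⟨hz.1, hxc.trans hz.2.1, hz.2.2⟩, fun h => ?_⟩
            exact lt_irrefl c (h ⟨hcP, hxc, hcy⟩).2.1
          have := Set.ncard_lt_ncard this hfin
          omega)
        convert (lenIdeal hm).add_mem h1 h2 using 1
        ring
  rcases lt_trichotomy x y with h | rfl | h
  · exact key _ x y hx hy h le_rfl
  · simp [(lenIdeal hm).zero_mem]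
  · convert (lenIdeal hm).neg_mem (key _ y x hy hx h le_rfl) using 1
    ring

theorem intCast_mem_lenIdeal {hm : 2 ≤ m} {k : ℤ} :
    (k : ℝ) ∈ lenIdeal hm ↔ (m : ℤ) - 1 ∣ k := by
  have h0 : (m : ℝ) ≠ 0 := by positivity
  constructor
  · rintro ⟨_, ⟨N, s, rfl⟩, h⟩
    obtain ⟨n, rfl | rfl⟩ := s.eq_nat_or_neg
    · refine ⟨N * m ^ n, ?_⟩
      have : (k : ℝ) = (m - 1) * (N * m ^ n) := by simpa using h
      exact_mod_cast this
    · have h1 : (k : ℝ) * m ^ n = (m - 1) * N := by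
        rw [h, zpow_neg, zpow_natCast]
        field_simp
      have h2 : k * (m : ℤ) ^ n = (m - 1) * N := by exact_mod_cast h1
      have h3 : IsCoprime ((m : ℤ) - 1) ((m : ℤ) ^ n) :=
        IsCoprime.pow_right ⟨-1, 1, by ring⟩
      exact h3.dvd_of_dvd_mul_right (Dvd.intro _ h2.symm)
  · rintro ⟨j, rfl⟩
    exact ⟨j, mAdic_int j, by push_cast; ring⟩

theorem exists_common_denominator (hm : 2 ≤ m) {x : ℝ} (hx : x ∈ mAdic m) :
    ∃ K : ℕ, ∀ k ≥ K, ∃ N : ℤ, x = N / (m : ℝ) ^ k := by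
  have h0 : (m : ℝ) ≠ 0 := by positivity
  obtain ⟨N, s, rfl⟩ := hx
  refine ⟨(-s).toNat, fun k hk => ?_⟩
  obtain ⟨j, hj⟩ : ∃ j : ℕ, s = j - k := ⟨(s + k).toNat, by omega⟩
  refine ⟨N * m ^ j, ?_⟩
  rw [hj, zpow_sub₀ h0]
  push_cast
  simp only [zpow_natCast]
  ring

/-- The homeomorphism which is the identity up to `p` and has slope `m` beyond `p`. -/
theorem exists_kink (hm : 2 ≤ m) {p : ℝ} (hp : p ∈ mAdic m) :
    ∃ e ∈ PL hm, (∀ x ≤ p, e x = x) ∧ ∀ x, p ≤ x → e x = p + m * (x - p) := by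
  obtain ⟨e, he, h1, h2⟩ := exists_glue hm (PL hm).one_mem
    (affineIso_mem hm 1 (c := p - m * p) (mAdic_sub hm hp (mAdic_int_mul hp m))) hp (by simp)
  refine ⟨e, he, fun x hx => by simp [h1 x hx], fun x hx => ?_⟩
  rw [h2 x hx, affineIso_apply]
  simp only [zpow_one]
  ring

/-- For `b - a ≥ m ^ (-k)` the length of `[a, b]` can be increased by any multiple of
`(m - 1) * m ^ (-k)`. -/
theorem exists_stretch (hm : 2 ≤ m) {a b : ℝ} (hb : b ∈ mAdic m)
    {k : ℕ} (hab : a + 1 / (m : ℝ) ^ k ≤ b) (j : ℕ) :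
    ∃ e ∈ PL hm, e a = a ∧ e b = b + j * (m - 1) / (m : ℝ) ^ k := by
  have h0 : (0 : ℝ) < m := by positivity
  have hu : 1 / (m : ℝ) ^ k ∈ mAdic m := ⟨1, -k, by simp⟩
  have hm1 : (0 : ℝ) ≤ (m : ℝ) - 1 := by
    have : (2 : ℝ) ≤ m := by exact_mod_cast hm
    linarith
  induction j with
  | zero => exact ⟨1, (PL hm).one_mem, by simp, by simp⟩
  | succ j ih =>
    obtain ⟨e, he, h1, h2⟩ := ih
    -- stretch the last subinterval of length `m ^ (-k)` by the factor `m`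
    have hpos : 0 ≤ j * ((m : ℝ) - 1) / (m : ℝ) ^ k := by positivity
    set b' := b + j * ((m : ℝ) - 1) / (m : ℝ) ^ k
    have hb' : b' ∈ mAdic m := h2 ▸ (he.1 b).2 hb
    obtain ⟨f, hf, h3, h4⟩ := exists_kink hm (mAdic_sub hm hb' hu)
    refine ⟨f * e, (PL hm).mul_mem hf he, ?_, ?_⟩
    · rw [RelIso.mul_apply, h1, h3 a (by linarith)]
    · rw [RelIso.mul_apply, h2, h4 b' (by have : 0 < 1 / (m : ℝ) ^ k := by positivity
                                          linarith)]
      simp only [b']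
      push_cast
      ring

/-- Two intervals with end points in `ℤ[1/m]` whose lengths are congruent modulo `m - 1` are
piecewise affinely homeomorphic: stretching by the factor `m` a subinterval of length `m ^ (-k)` of
the shorter one increases its length by `(m - 1) * m ^ (-k)`, and for large `k` the difference of
the lengths is a multiple of this number. -/
theorem exists_interval_map (hm : 2 ≤ m) {a b c d : ℝ} (ha : a ∈ mAdic m) (hb : b ∈ mAdic m)
    (hc : c ∈ mAdic m) (hd : d ∈ mAdic m) (hab : a < b) (hcd : c < d)
    (h : (b - a) - (d - c) ∈ lenIdeal hm) : ∃ e ∈ PL hm, e a = c ∧ e b = d := by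
  have h0 : (0 : ℝ) < m := by positivity
  have hm1 : (0 : ℝ) < (m : ℝ) - 1 := by
    have : (2 : ℝ) ≤ m := by exact_mod_cast hm
    linarith
  have key : ∀ {a b c d : ℝ}, a ∈ mAdic m → b ∈ mAdic m → c ∈ mAdic m → d ∈ mAdic m → a < b →
      c < d → b - a ≤ d - c → (b - a) - (d - c) ∈ lenIdeal hm →
      ∃ e ∈ PL hm, e a = c ∧ e b = d := by
    intro a b c d ha hb hc hd hab hcd hle h
    obtain ⟨z, hz, hzz⟩ := h
    obtain ⟨K₁, h1⟩ := exists_common_denominator hm (mAdic_sub hm hb ha)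
    obtain ⟨K₂, h2⟩ := exists_common_denominator hm hz
    obtain ⟨N, hN⟩ := h1 (max K₁ K₂) (le_max_left _ _)
    obtain ⟨Z, hZ⟩ := h2 (max K₁ K₂) (le_max_right _ _)
    set k := max K₁ K₂
    have hk : (0 : ℝ) < (m : ℝ) ^ k := by positivity
    have hN1 : (1 : ℝ) ≤ N := by
      have : (0 : ℝ) < N := by
        have : 0 < N / (m : ℝ) ^ k := by rw [← hN]; linarith
        exact (div_pos_iff_of_pos_right hk).1 this
      exact_mod_cast this
    have hab' : a + 1 / (m : ℝ) ^ k ≤ b := by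
      have : 1 / (m : ℝ) ^ k ≤ N / (m : ℝ) ^ k := by gcongr
      linarith
    have hZ0 : Z ≤ 0 := by
      have : z ≤ 0 := by
        by_contra! hz0
        have := mul_pos hm1 hz0
        linarith
      rw [hZ] at this
      have : (Z : ℝ) ≤ 0 := by
        by_contra! h3
        exact absurd this (not_le.2 (by positivity))
      exact_mod_cast this
    obtain ⟨j, rfl⟩ : ∃ j : ℕ, Z = -j := ⟨(-Z).toNat, by omega⟩
    obtain ⟨e, he, h3, h4⟩ := exists_stretch hm hb hab' j
    refine ⟨shift (c - a) * e, (PL hm).mul_mem (shift_mem_PL hm (mAdic_sub hm hc ha)) he, ?_, ?_⟩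
    · simp [h3]
    · rw [RelIso.mul_apply, h4, shift_apply]
      rw [hZ] at hzz
      push_cast at hzz
      linear_combination hzz
  rcases le_total (b - a) (d - c) with hle | hle
  · exact key ha hb hc hd hab hcd hle h
  · obtain ⟨e, he, h1, h2⟩ := key hc hd ha hb hcd hab hle (by
      convert (lenIdeal hm).neg_mem h using 1; ring)
    exact ⟨e⁻¹, (PL hm).inv_mem he, by simp [← h1], by simp [← h2]⟩

/-! ### Lifts of the elements of `T_{r,m}` to the line -/

/-- The group of the lifts to the line of the elements of `T_{r,m}`. -/
def lifts (r : ℕ) (hm : 2 ≤ m) : Subgroup (ℝ ≃o ℝ) :=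
  PL hm ⊓ Subgroup.centralizer {shift (r : ℝ)}

theorem mem_lifts {r : ℕ} {hm : 2 ≤ m} {e : ℝ ≃o ℝ} :
    e ∈ lifts r hm ↔ e ∈ PL hm ∧ Commute e (shift r) := by
  rw [lifts, Subgroup.mem_inf, Subgroup.mem_centralizer_singleton_iff]
  rfl

theorem shift_mem_lifts {r : ℕ} {hm : 2 ≤ m} : shift (r : ℝ) ∈ lifts r hm :=
  mem_lifts.2 ⟨shift_mem_PL hm (by simpa using mAdic_int (m := m) r), Commute.refl _⟩

theorem natCast_mem_mAdic (k : ℕ) : (k : ℝ) ∈ mAdic m := by simpa using mAdic_int (m := m) k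

/-- The map of the circle covered by an increasing homeomorphism of the line which commutes with
the translation by `r`. -/
def circleMap (r : ℕ) (e : ℝ ≃o ℝ) (he : Commute e (shift (r : ℝ))) : Circ r → Circ r :=
  Function.Periodic.lift (f := fun x => ((e x : ℝ) : Circ r)) (c := (r : ℝ)) fun x => by
    simp [commute_shift_iff.1 he]

@[simp] theorem circleMap_coe {r : ℕ} {e : ℝ ≃o ℝ} (he : Commute e (shift (r : ℝ))) (x : ℝ) :
    circleMap r e he (x : Circ r) = ((e x : ℝ) : Circ r) := rfl

theorem continuous_circleMap {r : ℕ} {e : ℝ ≃o ℝ} (he : Commute e (shift (r : ℝ))) :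
    Continuous (circleMap r e he) := by
  refine (QuotientAddGroup.isQuotientMap_mk (AddSubgroup.zmultiples (r : ℝ))).continuous_iff.2 ?_
  exact (AddCircle.continuous_mk' (r : ℝ)).comp e.continuous

/-- The homeomorphism of the circle covered by an increasing homeomorphism of the line which
commutes with the translation by `r`. -/
def circleHomeo (r : ℕ) (e : ℝ ≃o ℝ) (he : Commute e (shift (r : ℝ))) : Circ r ≃ₜ Circ r where
  toFun := circleMap r e he
  invFun := circleMap r e⁻¹ he.inv_left
  left_inv x := by
    obtain ⟨x, rfl⟩ := QuotientAddGroup.mk_surjective x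
    simp
  right_inv x := by
    obtain ⟨x, rfl⟩ := QuotientAddGroup.mk_surjective x
    simp
  continuous_toFun := continuous_circleMap he
  continuous_invFun := continuous_circleMap he.inv_left

theorem isIncreasingLift_circleHomeo {r : ℕ} {e : ℝ ≃o ℝ} (he : Commute e (shift (r : ℝ))) :
    IsIncreasingLift r (circleHomeo r e he) e where
  continuous := e.continuous
  strictMono := e.strictMono
  map_add := commute_shift_iff.1 he
  covers _ := rfl

/-- The projection of the group of lifts onto `T_{r,m}`. -/
def toT {r : ℕ} (hr : 1 ≤ r) (hm : 2 ≤ m) : lifts r hm →* BrownThompsonT r m hr hm where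
  toFun e := ⟨circleHomeo r e.1 (mem_lifts.1 e.2).2, (isElement_iff hr hm _).2
    ⟨e.1, isIncreasingLift_circleHomeo _, (mem_lifts.1 e.2).1⟩⟩
  map_one' := by
    ext x
    obtain ⟨x, rfl⟩ := QuotientAddGroup.mk_surjective x
    rfl
  map_mul' a b := by
    ext x
    obtain ⟨x, rfl⟩ := QuotientAddGroup.mk_surjective x
    rfl

theorem isIncreasingLift_toT {r : ℕ} {hr : 1 ≤ r} {hm : 2 ≤ m} (e : lifts r hm) :
    IsIncreasingLift r (toT hr hm e).1 e.1 :=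
  isIncreasingLift_circleHomeo _

theorem IsIncreasingLift.exists_orderIso {r : ℕ} {f : Circ r ≃ₜ Circ r} {F : ℝ → ℝ}
    (hF : IsIncreasingLift r f F) : ∃ e : ℝ ≃o ℝ, (⇑e = F) ∧ Commute e (shift (r : ℝ)) := by
  obtain ⟨G, -, h, -⟩ := hF.exists_inv
  exact ⟨hF.strictMono.orderIsoOfSurjective F fun y => ⟨G y, h y⟩, rfl,
    commute_shift_iff.2 hF.map_add⟩

theorem IsIncreasingLift.eq_add_of_one {r : ℕ} (hr : 1 ≤ r) {H : ℝ → ℝ}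
    (hH : IsIncreasingLift r 1 H) : ∃ k : ℤ, ∀ x, H x = x + k * r := by
  have h0 : (0 : ℝ) < r := by exact_mod_cast hr
  have h1 : ∀ x, ∃ j : ℤ, H x = x + j * r := fun x => by
    have h2 : ((H x - x : ℝ) : Circ r) = 0 := by
      rw [AddCircle.coe_sub, ← hH.covers]; exact sub_self _
    obtain ⟨j, hj⟩ := (AddCircle.coe_eq_zero_iff (r : ℝ)).1 h2
    rw [zsmul_eq_mul] at hj
    exact ⟨j, by linarith⟩
  obtain ⟨k, hk⟩ := h1 0
  rw [zero_add] at hk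
  have h3 : ∀ x : ℝ, 0 ≤ x → x < r → H x = x + k * r := by
    intro x hx hxr
    obtain ⟨j, hj⟩ := h1 x
    have h4 : k * r ≤ H x := hk ▸ hH.strictMono.monotone hx
    have h5 : H x < k * r + r := by
      rw [← hk, ← hH.map_add, zero_add]; exact hH.strictMono hxr
    have h6 : k < j + 1 := by
      have : (k : ℝ) * r < (j + 1) * r := by linarith
      exact_mod_cast lt_of_mul_lt_mul_right this h0.le
    have h7 : j < k + 1 := by
      have : (j : ℝ) * r < (k + 1) * r := by linarith
      exact_mod_cast lt_of_mul_lt_mul_right this h0.le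
    obtain rfl : j = k := by omega
    exact hj
  refine ⟨k, fun x => ?_⟩
  obtain ⟨j, hj1, hj2⟩ := exists_shift hr x
  have := h3 _ hj1 hj2
  rw [lift_add_int hH.map_add] at this
  linarith

/-- Two increasing lifts of the same homeomorphism differ by a multiple of `r`. -/
theorem IsIncreasingLift.eq_add {r : ℕ} (hr : 1 ≤ r) {f : Circ r ≃ₜ Circ r} {F G : ℝ → ℝ}
    (hF : IsIncreasingLift r f F) (hG : IsIncreasingLift r f G) :
    ∃ k : ℤ, ∀ x, G x = F x + k * r := by
  obtain ⟨F', hF', h1, -⟩ := hF.exists_inv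
  have h2 := hF'.comp hG
  rw [inv_mul_cancel] at h2
  obtain ⟨k, hk⟩ := h2.eq_add_of_one hr
  refine ⟨k, fun x => ?_⟩
  rw [← lift_add_int hF.map_add, ← hk, Function.comp, h1]

theorem toT_surjective {r : ℕ} (hr : 1 ≤ r) (hm : 2 ≤ m) : Function.Surjective (toT hr hm) := by
  rintro ⟨f, hf⟩
  obtain ⟨F, hF, hFg⟩ := (isElement_iff hr hm f).1 hf
  obtain ⟨e, rfl, he⟩ := hF.exists_orderIso
  refine ⟨⟨e, mem_lifts.2 ⟨hFg, he⟩⟩, Subtype.ext (Homeomorph.ext fun x => ?_)⟩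
  obtain ⟨x, rfl⟩ := QuotientAddGroup.mk_surjective x
  exact (hF.covers x).symm

theorem toT_eq_iff {r : ℕ} (hr : 1 ≤ r) (hm : 2 ≤ m) {a b : lifts r hm} :
    toT hr hm a = toT hr hm b ↔ ∃ k : ℤ, b.1 = a.1 * shift (r : ℝ) ^ k := by
  constructor
  · intro h
    have ha := isIncreasingLift_toT (hr := hr) a
    rw [h] at ha
    obtain ⟨k, hk⟩ := ha.eq_add hr (isIncreasingLift_toT b)
    refine ⟨k, ?_⟩
    ext x
    rw [hk, shift_zpow, RelIso.mul_apply, shift_apply,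
      lift_add_int (commute_shift_iff.1 (mem_lifts.1 a.2).2)]
  · rintro ⟨k, hk⟩
    refine Subtype.ext (Homeomorph.ext fun x => ?_)
    obtain ⟨x, rfl⟩ := QuotientAddGroup.mk_surjective x
    change ((a.1 x : ℝ) : Circ r) = ((b.1 x : ℝ) : Circ r)
    rw [hk, shift_zpow, RelIso.mul_apply, shift_apply,
      lift_add_int (commute_shift_iff.1 (mem_lifts.1 a.2).2), AddCircle.coe_add]
    have : ((k * r : ℝ) : Circ r) = 0 := (AddCircle.coe_eq_zero_iff (r : ℝ)).2 ⟨k, by simp⟩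
    rw [this, add_zero]

theorem toT_eq_one_iff {r : ℕ} (hr : 1 ≤ r) (hm : 2 ≤ m) {a : lifts r hm} :
    toT hr hm a = 1 ↔ ∃ k : ℤ, a.1 = shift (r : ℝ) ^ k := by
  rw [eq_comm, ← map_one (toT hr hm), toT_eq_iff]
  simp

/-! ### Elements of finite order and rotation numbers -/

theorem orderIso_eq_one_of_pow {e : ℝ ≃o ℝ} {n : ℕ} (hn : n ≠ 0) (h : e ^ n = 1) : e = 1 := by
  have key : ∀ e : ℝ ≃o ℝ, e ^ n = 1 → ∀ x, e x ≤ x := by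
    intro e h x
    by_contra! hx
    have key : ∀ k : ℕ, x < (e ^ (k + 1)) x := by
      intro k
      induction k with
      | zero => simpa using hx
      | succ k ih => rw [pow_succ, RelIso.mul_apply]; exact ih.trans ((e ^ (k + 1)).strictMono hx)
    obtain ⟨k, rfl⟩ := Nat.exists_eq_succ_of_ne_zero hn
    have := key k
    rw [h] at this
    simp at this
  ext x
  refine le_antisymm (key e h x) ?_
  have := e.monotone (key e⁻¹ (by rw [inv_pow, h, inv_one]) x)
  simpa using this

theorem shift_zpow_injective {r : ℕ} (hr : 1 ≤ r) :
    Function.Injective fun k : ℤ => shift (r : ℝ) ^ k := by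
  intro a b h
  have h0 : (0 : ℝ) < r := by exact_mod_cast hr
  simp only [shift_zpow] at h
  exact_mod_cast mul_right_cancel₀ h0.ne' (shift_injective h)

/-- If `e ^ q = z ^ p` with `p` and `q` coprime, then `e` and `z` are powers of a common element,
namely `z` is its `q`-th and `e` is its `p`-th power. -/
theorem exists_root_of_coprime {G : Type*} [Group G] {e z : G} (h : Commute e z) {p q u v : ℤ}
    (hq : e ^ q = z ^ p) (huv : u * p + v * q = 1) :
    (e ^ u * z ^ v) ^ q = z ∧ (e ^ u * z ^ v) ^ p = e := by
  have hc : Commute (e ^ u) (z ^ v) := (h.zpow_left u).zpow_right v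
  constructor
  · rw [hc.mul_zpow, ← zpow_mul, ← zpow_mul, mul_comm u q, zpow_mul, hq, ← zpow_mul, ← zpow_add,
      show p * u + v * q = 1 by linarith, zpow_one]
  · rw [hc.mul_zpow, ← zpow_mul, ← zpow_mul, mul_comm v p, zpow_mul z, ← hq, ← zpow_mul,
      ← zpow_add, show u * p + q * v = 1 by linarith, zpow_one]

/-- A lift of an element of finite order is a power of a root of the translation by `r`. -/
theorem exists_root {r : ℕ} {hm : 2 ≤ m} {e : ℝ ≃o ℝ} (he : e ∈ lifts r hm)
    {N : ℕ} (hN : N ≠ 0) {k : ℤ} (h : e ^ N = shift (r : ℝ) ^ k) :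
    ∃ F ∈ lifts r hm, ∃ (q : ℕ) (p : ℤ), q ≠ 0 ∧ IsCoprime p (q : ℤ) ∧ F ^ q = shift (r : ℝ) ∧
      F ^ p = e ∧ k * q = p * N := by
  have hc := (mem_lifts.1 he).2
  have hg : 0 < Int.gcd k N := Int.gcd_pos_of_ne_zero_right _ (by exact_mod_cast hN)
  obtain ⟨p, hp⟩ := Int.gcd_dvd_left k N
  obtain ⟨q, hq⟩ : Int.gcd k N ∣ N := by exact_mod_cast Int.gcd_dvd_right k N
  set d := Int.gcd k N
  have hq0 : q ≠ 0 := by rintro rfl; simp at hq; exact hN hq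
  have hcop : IsCoprime p (q : ℤ) := by
    have h1 := Int.gcd_eq_gcd_ab k N
    refine ⟨Int.gcdA k N, Int.gcdB k N, ?_⟩
    have h2 : (d : ℤ) ≠ 0 := by exact_mod_cast hg.ne'
    apply mul_left_cancel₀ h2
    have h3 : (N : ℤ) = d * q := by exact_mod_cast hq
    change (d : ℤ) = _ at h1
    rw [mul_one]
    linear_combination (-Int.gcdA k N) * hp - (Int.gcdB k N) * h3 - h1
  -- increasing homeomorphisms of the line have no torsion, so `gcd k N` can be cancelled
  have hroot : e ^ q * (shift (r : ℝ) ^ p)⁻¹ = 1 := by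
    refine orderIso_eq_one_of_pow hg.ne' ?_
    have hc' : Commute (e ^ q) (shift (r : ℝ) ^ p)⁻¹ := ((hc.zpow_right p).inv_right).pow_left q
    rw [hc'.mul_pow, ← pow_mul, mul_comm q, ← hq, h, inv_pow, ← zpow_natCast, ← zpow_mul,
      mul_comm p, ← hp, mul_inv_cancel]
  obtain ⟨u, v, huv⟩ := hcop
  have := exists_root_of_coprime hc (p := p) (q := q) (u := u) (v := v)
    (by rw [zpow_natCast]; exact mul_inv_eq_one.1 hroot) huv
  refine ⟨e ^ u * shift (r : ℝ) ^ v, (lifts r hm).mul_mem ((lifts r hm).zpow_mem he u)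
    ((lifts r hm).zpow_mem shift_mem_lifts v), q, p, hq0, ⟨u, v, huv⟩, ?_, this.2, ?_⟩
  · rw [← zpow_natCast]; exact this.1
  · have h3 : (N : ℤ) = d * q := by exact_mod_cast hq
    rw [h3, hp]; ring

theorem iterate_eq_pow (e : ℝ ≃o ℝ) (n : ℕ) (x : ℝ) : (⇑e)^[n] x = (e ^ n) x := by
  induction n with
  | zero => rfl
  | succ n ih => rw [Function.iterate_succ_apply', ih, pow_succ', RelIso.mul_apply]

/-- If `e ^ N` is the translation by `k * r`, then `e` has translation number `k / N` in units of
`r`: the deviation of `(e ^ n) 0` from `n * k * r / N` is periodic in `n`, hence bounded. -/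
theorem tendsto_rotation {r : ℕ} (hr : 1 ≤ r) {e : ℝ ≃o ℝ} {N : ℕ} (hN : N ≠ 0) {k : ℤ}
    (h : e ^ N = shift (r : ℝ) ^ k) :
    Tendsto (fun n : ℕ => (⇑e)^[n] 0 / (r * n)) atTop (𝓝 ((k : ℝ) / N)) := by
  have h0 : (0 : ℝ) < r := by exact_mod_cast hr
  have hN0 : (0 : ℝ) < N := by exact_mod_cast Nat.pos_of_ne_zero hN
  set D : ℕ → ℝ := fun n => (e ^ n) 0 - n * (k * r / N) with hD
  have hper : Function.Periodic D N := by
    intro n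
    simp only [hD]
    rw [add_comm n N, pow_add, h, shift_zpow, RelIso.mul_apply, shift_apply]
    push_cast
    field_simp
    ring
  obtain ⟨C, hC⟩ : ∃ C, ∀ n, |D n| ≤ C := by
    refine ⟨∑ i ∈ Finset.range N, |D i|, fun n => ?_⟩
    rw [← hper.map_mod_nat n]
    exact Finset.single_le_sum (f := fun i => |D i|) (fun i _ => abs_nonneg _)
      (Finset.mem_range.2 (Nat.mod_lt _ (Nat.pos_of_ne_zero hN)))
  have hlim : Tendsto (fun n : ℕ => D n / (r * n)) atTop (𝓝 0) := by
    have h1 : Tendsto (fun n : ℕ => (C / r) / (n : ℝ)) atTop (𝓝 0) :=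
      tendsto_const_div_atTop_nhds_zero_nat _
    refine squeeze_zero_norm (fun n => ?_) h1
    rw [Real.norm_eq_abs, abs_div, abs_of_nonneg (by positivity : (0 : ℝ) ≤ r * n), div_div]
    gcongr
    exact hC n
  have h2 := hlim.add_const ((k : ℝ) / N)
  rw [zero_add] at h2
  refine h2.congr' ?_
  filter_upwards [eventually_gt_atTop 0] with n hn
  have hn0 : (0 : ℝ) < n := by exact_mod_cast hn
  rw [iterate_eq_pow]
  simp only [hD]
  field_simp
  ring

theorem finOrder_of_root {r : ℕ} (hr : 1 ≤ r) (hm : 2 ≤ m) {F : lifts r hm} {q : ℕ}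
    (h : F.1 ^ q = shift (r : ℝ)) : toT hr hm F ^ q = 1 := by
  rw [← map_pow, toT_eq_one_iff]
  exact ⟨1, by simpa using h⟩

/-- The elements covered by powers of a root of the translation by `r` have finite order and a
rational rotation number. -/
theorem hasRotationNumber_of_root {r : ℕ} (hr : 1 ≤ r) (hm : 2 ≤ m) {F : lifts r hm} {θ : ℚ}
    (h : F.1 ^ θ.den = shift (r : ℝ)) :
    IsOfFinOrder (toT hr hm F ^ θ.num) ∧
      HasRotationNumber (toT hr hm F ^ θ.num).1 ((θ : ℝ) : AddCircle (1 : ℝ)) := by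
  refine ⟨(isOfFinOrder_iff_pow_eq_one.2
    ⟨θ.den, θ.den_pos, finOrder_of_root hr hm h⟩).zpow, ?_⟩
  rw [← map_zpow]
  refine ⟨_, (θ.num : ℝ) / θ.den, isIncreasingLift_toT _,
    tendsto_rotation hr θ.den_nz (k := θ.num) ?_, by rw [← Rat.cast_def]⟩
  rw [Subgroup.coe_zpow, ← zpow_natCast, zpow_comm, zpow_natCast, h]

/-- Every element of finite order and rotation number `θ` is covered by a power of a root of the
translation by `r`. -/
theorem exists_root_of_hasRotationNumber {r : ℕ} (hr : 1 ≤ r) (hm : 2 ≤ m)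
    {f : BrownThompsonT r m hr hm} {θ : ℚ} (hf : IsOfFinOrder f)
    (hθ : HasRotationNumber f.1 ((θ : ℝ) : AddCircle (1 : ℝ))) :
    ∃ F : lifts r hm, F.1 ^ θ.den = shift (r : ℝ) ∧ toT hr hm F ^ θ.num = f := by
  obtain ⟨G, t, hG, ht, htθ⟩ := hθ
  obtain ⟨e, rfl⟩ := toT_surjective hr hm f
  obtain ⟨j, hj⟩ := (isIncreasingLift_toT (hr := hr) e).eq_add hr hG
  obtain ⟨N, hN, hfN⟩ := isOfFinOrder_iff_pow_eq_one.1 hf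
  have hz : shift (r : ℝ) ∈ lifts r hm := shift_mem_lifts
  have hec : Commute e.1 (shift (r : ℝ)) := (mem_lifts.1 e.2).2
  have hGe : G = ⇑(e.1 * shift (r : ℝ) ^ j) := by
    funext x
    rw [hj, shift_zpow, RelIso.mul_apply, shift_apply, lift_add_int (commute_shift_iff.1 hec)]
  rw [← map_pow, toT_eq_one_iff] at hfN
  obtain ⟨k, hk⟩ := hfN
  have hpow : ∀ i : ℤ, (e.1 * shift (r : ℝ) ^ i) ^ N = shift (r : ℝ) ^ (k + i * N) := by
    intro i
    rw [(hec.zpow_right i).mul_pow, zpow_add, zpow_mul, zpow_natCast, ← hk]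
    rfl
  rw [hGe] at ht
  have h1 := tendsto_nhds_unique ht (tendsto_rotation hr hN.ne' (hpow j))
  have h2 : ((t - θ : ℝ) : AddCircle (1 : ℝ)) = 0 := by
    rw [AddCircle.coe_sub, htθ, sub_self]
  obtain ⟨i, hi⟩ := (AddCircle.coe_eq_zero_iff (1 : ℝ)).1 h2
  have hmem : e.1 * shift (r : ℝ) ^ (j - i) ∈ lifts r hm :=
    (lifts r hm).mul_mem e.2 ((lifts r hm).zpow_mem hz _)
  obtain ⟨F, hF, q, p, hq, hcop, hFq, hFp, hkq⟩ := exists_root hmem hN.ne' (hpow (j - i))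
  have hN0 : (N : ℝ) ≠ 0 := by exact_mod_cast hN.ne'
  have hq0 : (q : ℝ) ≠ 0 := by exact_mod_cast hq
  have h3 : θ = (p : ℚ) / (q : ℤ) := by
    have h4 : (θ : ℝ) = (p : ℝ) / q := by
      rw [eq_div_iff hq0]
      apply mul_right_cancel₀ hN0
      have h5 : ((k + (j - i) * N) * q : ℝ) = p * N := by exact_mod_cast hkq
      rw [← h5]
      have h6 : (θ : ℝ) = (k + j * N : ℝ) / N - i := by
        push_cast at h1
        rw [← h1]
        rw [zsmul_eq_mul, mul_one] at hi
        linarith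
      rw [h6]
      field_simp
      ring
    exact_mod_cast h4
  have hqpos : (0 : ℤ) < q := by exact_mod_cast Nat.pos_of_ne_zero hq
  have hcop' : Nat.Coprime p.natAbs (q : ℤ).natAbs := Int.isCoprime_iff_gcd_eq_one.1 hcop
  have h7 : θ.num = p := by rw [h3]; exact Rat.num_div_eq_of_coprime hqpos hcop'
  have h8 : θ.den = q := by
    have := Rat.den_div_eq_of_coprime hqpos hcop'
    rw [← h3] at this
    exact_mod_cast this
  refine ⟨⟨F, hF⟩, by rw [h8]; exact hFq, ?_⟩
  rw [h7, ← map_zpow, eq_comm, toT_eq_iff]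
  exact ⟨j - i, hFp⟩

/-- Every element of order `q` is a power, with an exponent prime to `q`, of the element covered
by a `q`-th root of the translation by `r`. -/
theorem exists_root_of_orderOf {r : ℕ} (hr : 1 ≤ r) (hm : 2 ≤ m)
    {f : BrownThompsonT r m hr hm} {n : ℕ} (hn : n ≠ 0) (hf : orderOf f = n) :
    ∃ (F : lifts r hm) (p : ℤ), F.1 ^ n = shift (r : ℝ) ∧ toT hr hm F ^ p = f ∧
      IsCoprime p (n : ℤ) := by
  obtain ⟨e, rfl⟩ := toT_surjective hr hm f
  have h1 : toT hr hm e ^ n = 1 := hf ▸ pow_orderOf_eq_one _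
  rw [← map_pow, toT_eq_one_iff] at h1
  obtain ⟨k, hk⟩ := h1
  obtain ⟨F, hF, q, p, hq, hcop, hFq, hFp, hkq⟩ := exists_root e.2 hn hk
  have h2 : toT hr hm ⟨F, hF⟩ ^ p = toT hr hm e := by
    rw [← map_zpow]; congr 1; exact Subtype.ext hFp
  have h3 : n ∣ q := by
    rw [← hf, orderOf_dvd_iff_pow_eq_one, ← h2, ← zpow_natCast, zpow_comm, zpow_natCast,
      finOrder_of_root hr hm hFq, one_zpow]
  have h4 : (q : ℤ) ∣ n := hcop.symm.dvd_of_dvd_mul_left (Dvd.intro_left k hkq)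
  obtain rfl : q = n := Nat.dvd_antisymm (by exact_mod_cast h4) h3
  exact ⟨⟨F, hF⟩, p, hFq, h2, hcop⟩

theorem orderOf_root {r : ℕ} (hr : 1 ≤ r) (hm : 2 ≤ m) {F : lifts r hm} {q : ℕ}
    (h : F.1 ^ q = shift (r : ℝ)) : orderOf (toT hr hm F) = q := by
  refine Nat.dvd_antisymm (orderOf_dvd_of_pow_eq_one (finOrder_of_root hr hm h)) ?_
  have h1 := pow_orderOf_eq_one (toT hr hm F)
  rw [← map_pow, toT_eq_one_iff] at h1
  obtain ⟨k, hk⟩ := h1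
  have h2 : shift (r : ℝ) ^ (orderOf (toT hr hm F) : ℤ) = shift (r : ℝ) ^ (k * q) := by
    rw [zpow_mul, ← hk, Subgroup.coe_pow, zpow_natCast, zpow_natCast, ← pow_mul, mul_comm,
      pow_mul, h]
  have h3 := shift_zpow_injective hr h2
  exact Int.natCast_dvd_natCast.1 ⟨k, by rw [h3]; ring⟩

/-! ### Conjugacy of the roots of the translation by `r` -/

theorem lifts_sub_mem {r : ℕ} {hm : 2 ≤ m} {e : ℝ ≃o ℝ} (he : e ∈ lifts r hm) {x y : ℝ}
    (hx : x ∈ mAdic m) (hy : y ∈ mAdic m) : (e y - y) - (e x - x) ∈ lenIdeal hm :=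
  PL_sub_mem (mem_lifts.1 he).1 hx hy

theorem lifts_mAdic {r : ℕ} {hm : 2 ≤ m} {e : ℝ ≃o ℝ} (he : e ∈ lifts r hm) {x : ℝ}
    (hx : x ∈ mAdic m) : e x ∈ mAdic m :=
  ((mem_lifts.1 he).1.1 x).2 hx

/-- The displacement of a lift modulo `m - 1`, a homomorphism to `ℝ / (m - 1)ℤ[1/m]`. -/
def displacement (r : ℕ) (hm : 2 ≤ m) :
    lifts r hm →* Multiplicative (ℝ ⧸ lenIdeal hm) where
  toFun e := Multiplicative.ofAdd ((e.1 0 : ℝ) : ℝ ⧸ lenIdeal hm)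
  map_one' := rfl
  map_mul' a b := by
    rw [← ofAdd_add, ← QuotientAddGroup.mk_add]
    refine congrArg _ (QuotientAddGroup.eq.2 ?_)
    have := lifts_sub_mem a.2 mAdic_zero (lifts_mAdic b.2 mAdic_zero)
    convert (lenIdeal hm).neg_mem this using 1
    simp only [Subgroup.coe_mul, RelIso.mul_apply]
    ring

theorem displacement_eq_iff {r : ℕ} {hm : 2 ≤ m} {a b : lifts r hm} :
    displacement r hm a = displacement r hm b ↔ a.1 0 - b.1 0 ∈ lenIdeal hm := by
  change ((a.1 0 : ℝ) : ℝ ⧸ lenIdeal hm) = ((b.1 0 : ℝ) : ℝ ⧸ lenIdeal hm) ↔ _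
  rw [QuotientAddGroup.eq, ← neg_mem_iff]
  ring_nf

/-- Two `q`-th roots of the translation by `r` whose displacements are congruent modulo `m - 1`
are conjugate. -/
theorem exists_conj_of_roots {r : ℕ} (hr : 1 ≤ r) (hm : 2 ≤ m) {F G : lifts r hm} {q : ℕ}
    (hF : F.1 ^ q = shift (r : ℝ)) (hG : G.1 ^ q = shift (r : ℝ))
    (h : F.1 0 - G.1 0 ∈ lenIdeal hm) : ∃ Q : lifts r hm, Q * F * Q⁻¹ = G := by
  have h0 : (0 : ℝ) < r := by exact_mod_cast hr
  have hF0 := lt_of_pow_eq_shift h0 hF 0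
  have hG0 := lt_of_pow_eq_shift h0 hG 0
  have hl := lifts_mAdic F.2 mAdic_zero
  obtain ⟨H, hH, h1, h2⟩ := exists_interval_map hm mAdic_zero hl mAdic_zero
    (lifts_mAdic G.2 mAdic_zero) hF0 hG0 (by simpa using h)
  obtain ⟨Ψ, hΨ, -, hΨF⟩ := exists_equivariant hm (mem_lifts.1 F.2).1 (PL hm).one_mem h0 hF hF0
    hl (by simp)
  obtain ⟨Φ, hΦ, -, hΦG⟩ := exists_equivariant hm (mem_lifts.1 G.2).1 hH h0 hG hF0
    hl (by rw [h1, h2])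
  -- `Ψ` and `Φ` conjugate the translation by `F 0` to `F` and to `G`
  set Q := Φ * Ψ⁻¹ with hQ
  have hQF : Q * F.1 * Q⁻¹ = G.1 := by
    have e1 : F.1 = Ψ * shift (F.1 0) * Ψ⁻¹ := eq_mul_inv_of_mul_eq hΨF.symm
    have e2 : G.1 = Φ * shift (F.1 0) * Φ⁻¹ := eq_mul_inv_of_mul_eq hΦG.symm
    rw [hQ, e2]
    nth_rw 1 [e1]
    group
  have hQr : Q * shift (r : ℝ) * Q⁻¹ = shift (r : ℝ) := by
    nth_rw 1 [← hF]
    rw [← conj_pow, hQF, hG]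
  have hmem : Q ∈ lifts r hm := mem_lifts.2
    ⟨(PL hm).mul_mem hΦ ((PL hm).inv_mem hΨ), mul_inv_eq_iff_eq_mul.1 hQr⟩
  exact ⟨⟨Q, hmem⟩, Subtype.ext hQF⟩

/-- If `Ψ` conjugates the translation by `q * l` to the translation by `r`, then it conjugates the
translation by `l` to a `q`-th root of the latter. -/
theorem conj_shift_mem {r : ℕ} {hm : 2 ≤ m} {Ψ : ℝ ≃o ℝ} (hΨ : Ψ ∈ PL hm) {l : ℝ} {q : ℕ}
    (hl : l ∈ mAdic m) (h : Ψ * shift (q * l) = shift (r : ℝ) * Ψ) :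
    Ψ * shift l * Ψ⁻¹ ∈ lifts r hm ∧ (Ψ * shift l * Ψ⁻¹) ^ q = shift (r : ℝ) := by
  have h1 : (Ψ * shift l * Ψ⁻¹) ^ q = shift (r : ℝ) := by
    rw [conj_pow, shift_pow, h, mul_inv_cancel_right]
  refine ⟨mem_lifts.2 ⟨(PL hm).mul_mem ((PL hm).mul_mem hΨ (shift_mem_PL hm hl))
    ((PL hm).inv_mem hΨ), ?_⟩, h1⟩
  rw [← h1]
  exact Commute.self_pow _ q

/-- A `q`-th root of the translation by `r` with displacement `l` modulo `m - 1` exists as soon as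
`q * l` and `r` are congruent modulo `m - 1`. -/
theorem exists_root_displacement {r : ℕ} (hr : 1 ≤ r) (hm : 2 ≤ m) {q : ℕ} (hq : q ≠ 0) {l : ℝ}
    (hl : l ∈ mAdic m) (hl0 : 0 < l) (h : q * l - r ∈ lenIdeal hm) :
    ∃ F : lifts r hm, F.1 ^ q = shift (r : ℝ) ∧ F.1 0 - l ∈ lenIdeal hm := by
  have h0 : (0 : ℝ) < r := by exact_mod_cast hr
  have hq0 : (0 : ℝ) < q := by exact_mod_cast Nat.pos_of_ne_zero hq
  have hqm : (q : ℝ) * l ∈ mAdic m := by exact_mod_cast mAdic_int_mul hl q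
  obtain ⟨H, hH, h1, h2⟩ := exists_interval_map hm mAdic_zero hqm mAdic_zero
    (natCast_mem_mAdic r) (by positivity) h0 (by simpa using h)
  obtain ⟨Ψ, hΨ, hΨH, hΨr⟩ := exists_equivariant hm (shift_mem_PL hm (natCast_mem_mAdic r)) hH h0
    (pow_one _) (by positivity) hqm (by simp [h1, h2])
  obtain ⟨h3, h4⟩ := conj_shift_mem hΨ hl hΨr
  refine ⟨⟨_, h3⟩, h4, ?_⟩
  have h5 : Ψ 0 = 0 := by rw [hΨH 0 ⟨le_rfl, by positivity⟩, h1]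
  have h6 : Ψ⁻¹ 0 = 0 := by
    rw [← h5]
    exact (RelIso.inv_apply_self Ψ 0).trans h5.symm
  have h7 := PL_sub_mem hΨ mAdic_zero hl
  simpa [h5, h6] using h7

/-- A `q`-th root of the translation by `r` has a displacement `l` with `q * l ≡ r` modulo
`m - 1`. -/
theorem displacement_root {r : ℕ} (hm : 2 ≤ m) {F : lifts r hm} {q : ℕ}
    (hF : F.1 ^ q = shift (r : ℝ)) : r - q * F.1 0 ∈ lenIdeal hm := by
  have h1 : displacement r hm (F ^ q) = displacement r hm F ^ q := map_pow _ _ _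
  have h2 : (F ^ q).1 0 = r := by rw [Subgroup.coe_pow, hF, shift_apply, zero_add]
  have h3 : displacement r hm F ^ q =
      Multiplicative.ofAdd (((q * F.1 0 : ℝ)) : ℝ ⧸ lenIdeal hm) := by
    change Multiplicative.ofAdd ((F.1 0 : ℝ) : ℝ ⧸ lenIdeal hm) ^ q = _
    rw [← ofAdd_nsmul, ← QuotientAddGroup.mk_nsmul, nsmul_eq_mul]
  rw [h3] at h1
  have h4 : (((F ^ q).1 0 : ℝ) : ℝ ⧸ lenIdeal hm) = ((q * F.1 0 : ℝ) : ℝ ⧸ lenIdeal hm) := h1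
  rw [h2, QuotientAddGroup.eq, ← neg_mem_iff] at h4
  convert h4 using 1
  ring

/-! ### Conjugacy classes of elements of finite order -/

theorem mem_lenIdeal_two {x : ℝ} (hx : x ∈ mAdic 2) : x ∈ lenIdeal (le_refl 2) :=
  ⟨x, hx, by norm_num⟩

theorem natCast_mem_lenIdeal {hm : 2 ≤ m} {k : ℕ} : (k : ℝ) ∈ lenIdeal hm ↔ m - 1 ∣ k := by
  rw [← Int.cast_natCast, intCast_mem_lenIdeal, ← Int.natCast_dvd_natCast, Nat.cast_sub (by omega)]
  rfl

/-- For `m = 2` there is no obstruction: roots of the translation by `r` of all orders exist. -/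
theorem exists_root_two {r : ℕ} (hr : 1 ≤ r) {q : ℕ} (hq : q ≠ 0) :
    ∃ F : lifts r (le_refl 2), F.1 ^ q = shift (r : ℝ) := by
  obtain ⟨F, hF, -⟩ := exists_root_displacement hr (le_refl 2) hq
    (l := 1) (by simpa using natCast_mem_mAdic (m := 2) 1) one_pos
    (mem_lenIdeal_two (by
      rw [mul_one]
      exact mAdic_sub le_rfl (natCast_mem_mAdic q) (natCast_mem_mAdic r)))
  exact ⟨F, hF⟩

theorem exists_conj_of_roots_two {r : ℕ} (hr : 1 ≤ r) {F G : lifts r (le_refl 2)} {q : ℕ}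
    (hF : F.1 ^ q = shift (r : ℝ)) (hG : G.1 ^ q = shift (r : ℝ)) :
    ∃ Q : lifts r (le_refl 2), Q * F * Q⁻¹ = G :=
  exists_conj_of_roots hr le_rfl hF hG (mem_lenIdeal_two
    (mAdic_sub le_rfl (lifts_mAdic F.2 mAdic_zero) (lifts_mAdic G.2 mAdic_zero)))

/-- There is an `(m - 1)`-th root of the translation by `r` only if `m - 1` divides `r`. -/
theorem dvd_of_root {r : ℕ} {hm : 2 ≤ m} {F : lifts r hm} (hF : F.1 ^ (m - 1) = shift (r : ℝ)) :
    m - 1 ∣ r := by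
  rw [← natCast_mem_lenIdeal (hm := hm)]
  have h1 := displacement_root hm hF
  have h2 : ((m - 1 : ℕ) : ℝ) * F.1 0 ∈ lenIdeal hm :=
    ⟨F.1 0, lifts_mAdic F.2 mAdic_zero, by rw [Nat.cast_sub (by omega), Nat.cast_one]⟩
  simpa using (lenIdeal hm).add_mem h1 h2

/-- If `m ≠ 2` and `m - 1` divides `r`, the cyclic subgroups of order `m - 1` of `T_{r,m}` form
several conjugacy classes, as the displacement modulo `m - 1` of a generator is arbitrary. -/
theorem exists_nonconj_roots {r : ℕ} (hr : 1 ≤ r) (hm : 2 ≤ m) (hm2 : m ≠ 2) (h : m - 1 ∣ r) :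
    ∃ F G : lifts r hm, F.1 ^ (m - 1) = shift (r : ℝ) ∧ G.1 ^ (m - 1) = shift (r : ℝ) ∧
      ∀ j : ℤ, ¬ IsConj (toT hr hm F ^ j) (toT hr hm G) := by
  have hr' : (r : ℝ) ∈ lenIdeal hm := natCast_mem_lenIdeal.2 h
  have hmm : ∀ l : ℕ, ((m - 1 : ℕ) : ℝ) * (l : ℝ) - r ∈ lenIdeal hm := fun l =>
    (lenIdeal hm).sub_mem (by
      rw [← Nat.cast_mul]
      exact natCast_mem_lenIdeal.2 (Dvd.intro _ rfl)) hr'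
  -- `F` has displacement `m - 1 ≡ 0` and `G` has displacement `1`
  obtain ⟨F, hF, hF0⟩ := exists_root_displacement hr hm (q := m - 1) (by omega)
    (natCast_mem_mAdic (m - 1)) (by exact_mod_cast (by omega : 0 < m - 1)) (hmm _)
  obtain ⟨G, hG, hG0⟩ := exists_root_displacement hr hm (q := m - 1) (by omega)
    (natCast_mem_mAdic 1) (by simp) (hmm _)
  refine ⟨F, G, hF, hG, fun j hj => ?_⟩
  obtain ⟨c, hc⟩ := isConj_iff.1 hj
  obtain ⟨Q, rfl⟩ := toT_surjective hr hm c
  rw [← map_zpow, ← map_mul, ← map_inv, ← map_mul, toT_eq_iff] at hc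
  obtain ⟨k, hk⟩ := hc
  have hG' : G = Q * F ^ j * Q⁻¹ * (⟨shift (r : ℝ), shift_mem_lifts⟩ : lifts r hm) ^ k :=
    Subtype.ext (by rw [hk]; rfl)
  have hz : displacement r hm ⟨shift (r : ℝ), shift_mem_lifts⟩ = 1 := by
    rw [← map_one (displacement r hm), displacement_eq_iff]
    simpa using hr'
  have hFd : displacement r hm F = 1 := by
    rw [← map_one (displacement r hm), displacement_eq_iff]
    have := (lenIdeal hm).add_mem hF0 (natCast_mem_lenIdeal (hm := hm).2 (dvd_refl (m - 1)))
    simpa using this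
  have hGd : displacement r hm G = 1 := by
    rw [hG']
    simp only [map_mul, map_zpow, map_inv, hFd, hz, one_zpow, mul_one, mul_inv_cancel]
  rw [← map_one (displacement r hm), displacement_eq_iff] at hGd
  have h1 := (lenIdeal hm).sub_mem hGd hG0
  have h2 : ((1 : ℕ) : ℝ) ∈ lenIdeal hm := by
    convert h1 using 1
    simp
  have := Nat.dvd_one.1 (natCast_mem_lenIdeal.1 h2)
  omega

theorem existsUnique_conjClass_two {r : ℕ} (hr : 1 ≤ r) (θ : ℚ) :
    ∃! C : ConjClasses (BrownThompsonT r 2 hr (le_refl 2)), ∀ f ∈ C.carrier,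
      IsOfFinOrder f ∧ HasRotationNumber f.1 ((θ : ℝ) : AddCircle (1 : ℝ)) := by
  obtain ⟨F, hF⟩ := exists_root_two hr θ.den_nz
  refine ⟨ConjClasses.mk (toT hr le_rfl F ^ θ.num), fun g hg => ?_, fun C hC => ?_⟩
  · rw [ConjClasses.mem_carrier_iff_mk_eq, ConjClasses.mk_eq_mk_iff_isConj, isConj_comm,
      isConj_iff] at hg
    obtain ⟨c, rfl⟩ := hg
    obtain ⟨Q, rfl⟩ := toT_surjective hr le_rfl c
    rw [← conj_zpow, ← map_mul, ← map_inv, ← map_mul]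
    refine hasRotationNumber_of_root hr le_rfl ?_
    rw [Subgroup.coe_mul, Subgroup.coe_mul, Subgroup.coe_inv, conj_pow, hF,
      (mem_lifts.1 Q.2).2.eq, mul_inv_cancel_right]
  · obtain ⟨g, rfl⟩ := ConjClasses.exists_rep C
    obtain ⟨h1, h2⟩ := hC g ConjClasses.mem_carrier_mk
    obtain ⟨G, hG, rfl⟩ := exists_root_of_hasRotationNumber hr le_rfl h1 h2
    obtain ⟨Q, hQ⟩ := exists_conj_of_roots_two hr hG hF
    refine ConjClasses.mk_eq_mk_iff_isConj.2 (isConj_iff.2 ⟨toT hr le_rfl Q, ?_⟩)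
    rw [← conj_zpow, ← map_mul, ← map_inv, ← map_mul, hQ]

theorem eq_two_of_existsUnique {r : ℕ} (hr : 1 ≤ r) (hm : 2 ≤ m)
    (h : ∀ θ : ℚ, ∃! C : ConjClasses (BrownThompsonT r m hr hm), ∀ f ∈ C.carrier,
      IsOfFinOrder f ∧ HasRotationNumber f.1 ((θ : ℝ) : AddCircle (1 : ℝ))) : m = 2 := by
  by_contra hm2
  -- for order `m - 1` the condition `q * l ≡ r` on the displacement `l` does not involve `l`
  set θ : ℚ := ((m - 1 : ℕ) : ℚ)⁻¹ with hθ
  have hden : θ.den = m - 1 := by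
    rw [hθ, Rat.inv_natCast_den_of_pos (by omega)]
  have hnum : θ.num = 1 := Rat.inv_natCast_num_of_pos (by omega)
  obtain ⟨C, hC, hCu⟩ := h θ
  have hdvd : m - 1 ∣ r := by
    obtain ⟨g, rfl⟩ := ConjClasses.exists_rep C
    obtain ⟨h1, h2⟩ := hC g ConjClasses.mem_carrier_mk
    obtain ⟨F, hF, -⟩ := exists_root_of_hasRotationNumber hr hm h1 h2
    exact dvd_of_root (hden ▸ hF)
  obtain ⟨F, G, hF, hG, hFG⟩ := exists_nonconj_roots hr hm hm2 hdvd
  have key : ∀ E : lifts r hm, E.1 ^ (m - 1) = shift (r : ℝ) →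
      ConjClasses.mk (toT hr hm E) = C := by
    intro E hE
    refine hCu _ fun g hg => ?_
    rw [ConjClasses.mem_carrier_iff_mk_eq, ConjClasses.mk_eq_mk_iff_isConj, isConj_comm,
      isConj_iff] at hg
    obtain ⟨c, rfl⟩ := hg
    obtain ⟨Q, rfl⟩ := toT_surjective hr hm c
    rw [← map_mul, ← map_inv, ← map_mul, ← zpow_one (toT hr hm _), ← hnum]
    refine hasRotationNumber_of_root hr hm ?_
    rw [Subgroup.coe_mul, Subgroup.coe_mul, Subgroup.coe_inv, conj_pow, hden, hE,
      (mem_lifts.1 Q.2).2.eq, mul_inv_cancel_right]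
  refine hFG 1 ?_
  rw [zpow_one, ← ConjClasses.mk_eq_mk_iff_isConj, key F hF, key G hG]

/-- In `T`, two elements of the same finite order generate conjugate subgroups. -/
theorem exists_isConj_zpow {f g : ThompsonT} {q : ℕ} (hq : q ≠ 0) (hf : orderOf f = q)
    (hg : orderOf g = q) : ∃ j : ℤ, IsConj (f ^ j) g := by
  obtain ⟨F, p, hF, rfl, u, v, huv⟩ := exists_root_of_orderOf le_rfl le_rfl hq hf
  obtain ⟨G, p', hG, rfl, -⟩ := exists_root_of_orderOf le_rfl le_rfl hq hg
  obtain ⟨Q, hQ⟩ := exists_conj_of_roots_two le_rfl hF hG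
  refine ⟨u * p', isConj_iff.2 ⟨toT le_rfl le_rfl Q, ?_⟩⟩
  have h1 : (toT le_rfl le_rfl F ^ p) ^ (u * p') = toT le_rfl le_rfl F ^ p' := by
    rw [← zpow_mul, show p * (u * p') = p' + q * (-(v * p')) by linear_combination p' * huv,
      zpow_add, zpow_mul _ (q : ℤ), zpow_natCast, finOrder_of_root le_rfl le_rfl hF, one_zpow,
      mul_one]
  rw [h1, ← conj_zpow, ← map_mul, ← map_inv, ← map_mul, hQ]

theorem isEmpty_mulEquiv {r : ℕ} (hr : 1 ≤ r) (hm : 2 ≤ m) (hm2 : m ≠ 2) :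
    IsEmpty (ThompsonT ≃* BrownThompsonT r m hr hm) := by
  refine ⟨fun Θ => ?_⟩
  have hq : m - 1 ≠ 0 := by omega
  obtain ⟨E, hE⟩ := exists_root_two le_rfl hq
  have hdvd : m - 1 ∣ r := by
    have h1 : orderOf (Θ (toT le_rfl le_rfl E)) = m - 1 := by
      rw [MulEquiv.orderOf_eq, orderOf_root le_rfl le_rfl hE]
    obtain ⟨F, -, hF, -⟩ := exists_root_of_orderOf hr hm hq h1
    exact dvd_of_root hF
  obtain ⟨F, G, hF, hG, hFG⟩ := exists_nonconj_roots hr hm hm2 hdvd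
  obtain ⟨j, hj⟩ := exists_isConj_zpow (f := Θ.symm (toT hr hm F)) (g := Θ.symm (toT hr hm G)) hq
    (by rw [MulEquiv.orderOf_eq, orderOf_root hr hm hF])
    (by rw [MulEquiv.orderOf_eq, orderOf_root hr hm hG])
  have h2 := Θ.toMonoidHom.map_isConj hj
  refine hFG j ?_
  simpa using h2

/-! ### Halving an interval of a subdivision -/

/-- The dyadic piecewise affine homeomorphisms of the line which intertwine the translations by
`n` and by `k`. -/
def intertwiners (n k : ℕ) : Set (ℝ ≃o ℝ) :=
  {φ | φ ∈ PL (le_refl 2) ∧ φ * shift (n : ℝ) = shift (k : ℝ) * φ}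

theorem intertwiners_mul {n k l : ℕ} {φ ψ : ℝ ≃o ℝ} (hφ : φ ∈ intertwiners k l)
    (hψ : ψ ∈ intertwiners n k) : φ * ψ ∈ intertwiners n l :=
  ⟨(PL _).mul_mem hφ.1 hψ.1, by rw [mul_assoc, hψ.2, ← mul_assoc, hφ.2, mul_assoc]⟩

theorem intertwiners_inv {n k : ℕ} {φ : ℝ ≃o ℝ} (hφ : φ ∈ intertwiners n k) :
    φ⁻¹ ∈ intertwiners k n :=
  ⟨(PL _).inv_mem hφ.1, by rw [eq_comm, eq_inv_mul_iff_mul_eq, ← mul_assoc, hφ.2,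
    mul_inv_cancel_right]⟩

theorem shift_mem_intertwiners (n : ℕ) (j : ℤ) : shift (j : ℝ) ∈ intertwiners n n :=
  ⟨shift_mem_PL _ (mAdic_int j), by rw [shift_mul, shift_mul, add_comm]⟩

theorem one_mem_intertwiners (n : ℕ) : (1 : ℝ ≃o ℝ) ∈ intertwiners n n :=
  ⟨(PL _).one_mem, by simp⟩

theorem mem_lifts_iff_intertwiners {n : ℕ} {φ : ℝ ≃o ℝ} :
    φ ∈ lifts n (le_refl 2) ↔ φ ∈ intertwiners n n := mem_lifts

theorem intertwiners_apply {n k : ℕ} {φ : ℝ ≃o ℝ} (hφ : φ ∈ intertwiners n k) (x : ℝ) :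
    φ (x + n) = φ x + k := DFunLike.congr_fun hφ.2 x

theorem intertwiners_apply_int {n k : ℕ} {φ : ℝ ≃o ℝ} (hφ : φ ∈ intertwiners n k) (x : ℝ)
    (j : ℤ) : φ (x + j * n) = φ x + j * k := by
  induction j with
  | zero => simp
  | succ j ih =>
    have := intertwiners_apply hφ (x + j * n)
    push_cast at ih ⊢
    rw [ih] at this
    rw [show x + (j + 1) * (n : ℝ) = x + j * n + n by ring, this]
    ring
  | pred j ih =>
    have := intertwiners_apply hφ (x + (-j - 1) * n)
    push_cast at ih ⊢
    rw [show x + (-(j : ℝ) - 1) * n + n = x + -j * n by ring, ih] at this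
    linarith

theorem intertwiners_ext {n k : ℕ} (hn : n ≠ 0) {φ ψ : ℝ ≃o ℝ} (hφ : φ ∈ intertwiners n k)
    (hψ : ψ ∈ intertwiners n k) (h : ∀ x : ℝ, 0 ≤ x → x ≤ n → φ x = ψ x) : φ = ψ := by
  ext x
  obtain ⟨j, h1, h2⟩ := exists_shift (Nat.pos_of_ne_zero hn) x
  have h3 := h _ h1 h2.le
  rw [intertwiners_apply_int hφ, intertwiners_apply_int hψ] at h3
  linarith

theorem exists_intertwiner {n : ℕ} (hn : n ≠ 0) : ∃ φ, φ ∈ intertwiners n 1 := by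
  have hn0 : (0 : ℝ) < n := by exact_mod_cast Nat.pos_of_ne_zero hn
  have hnm := natCast_mem_mAdic (m := 2) n
  have h1m := natCast_mem_mAdic (m := 2) 1
  obtain ⟨H, hH, h1, h2⟩ := exists_interval_map le_rfl mAdic_zero hnm mAdic_zero h1m hn0 (by simp)
    (mem_lenIdeal_two (by simpa using mAdic_sub le_rfl hnm h1m))
  obtain ⟨Ψ, hΨ, -, h⟩ := exists_equivariant le_rfl (shift_mem_PL le_rfl h1m) hH (by simp)
    (pow_one _) hn0 hnm (by simp [h1, h2])
  exact ⟨Ψ, hΨ, h⟩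

/-- For a circle of length `n` subdivided into `n` unit intervals, the map which describes the
halving of the interval `[0, 1]`: it maps the `n + 1` unit intervals of the circle of length
`n + 1` to the two halves of `[0, 1]` and to the other `n - 1` unit intervals. -/
structure IsHalving (n : ℕ) (h : ℝ ≃o ℝ) : Prop where
  mem : h ∈ intertwiners (n + 1) n
  left : ∀ x : ℝ, 0 ≤ x → x ≤ 2 → h x = x / 2
  right : ∀ x : ℝ, 2 ≤ x → x ≤ n + 1 → h x = x - 1

theorem exists_isHalving {n : ℕ} (hn : 2 ≤ n) : ∃ h, IsHalving n h := by
  have hn' : (2 : ℝ) ≤ n := by exact_mod_cast hn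
  obtain ⟨e, he, h1, h2⟩ := exists_glue le_rfl (affineIso_mem le_rfl (-1) mAdic_zero)
    (shift_mem_PL le_rfl (c := -1) (by simpa using mAdic_int (m := 2) (-1)))
    (a := 2) (natCast_mem_mAdic 2) (by norm_num [affineIso_apply])
  have h1' : ∀ x ≤ 2, e x = x / 2 := fun x hx => by
    rw [h1 x hx, affineIso_apply]
    norm_num
    ring
  have h2' : ∀ x, 2 ≤ x → e x = x - 1 := fun x hx => by
    rw [h2 x hx, shift_apply, sub_eq_add_neg]
  obtain ⟨Ψ, hΨ, h3, h⟩ := exists_equivariant le_rfl (shift_mem_PL le_rfl (natCast_mem_mAdic n)) he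
    (by positivity) (pow_one _) (by positivity) (natCast_mem_mAdic (n + 1))
    (by rw [h1' 0 (by norm_num), h2' _ (by push_cast; linarith)]; simp)
  refine ⟨Ψ, ⟨hΨ, h⟩, fun x h0 hx => ?_, fun x hx hxn => ?_⟩
  · rw [h3 x ⟨h0, by push_cast; linarith⟩, h1' x hx]
  · rw [h3 x ⟨by linarith, by push_cast; linarith⟩, h2' x hx]

/-- Halving first the interval `[1, 2]` and then `[0, 1]`, or first `[0, 1]` and then the interval
which `[1, 2]` has become, gives the same subdivision. -/
theorem IsHalving.relation {n : ℕ} (hn : 2 ≤ n) {h k : ℝ ≃o ℝ} (hh : IsHalving n h)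
    (hk : IsHalving (n + 1) k) :
    shift 1 * h * (shift 1)⁻¹ * k = h * (shift 1 * shift 1 * k * (shift 1)⁻¹ * (shift 1)⁻¹) := by
  have hn' : (2 : ℝ) ≤ n := by exact_mod_cast hn
  have hs : ∀ l : ℕ, shift 1 ∈ intertwiners l l := fun l => by
    simpa using shift_mem_intertwiners l 1
  have hs' := fun l => intertwiners_inv (hs l)
  refine intertwiners_ext (n := n + 1 + 1) (by omega)
    (intertwiners_mul (intertwiners_mul (intertwiners_mul (hs _) hh.mem) (hs' _)) hk.mem)
    (intertwiners_mul hh.mem (intertwiners_mul (intertwiners_mul (intertwiners_mul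
      (intertwiners_mul (hs _) (hs _)) hk.mem) (hs' _)) (hs' _))) ?_
  intro x hx0 hxn
  push_cast at hxn
  simp only [RelIso.mul_apply, shift_inv, shift_apply]
  have e1 : x + -1 + -1 = x - 2 := by ring
  have hkr : ∀ x : ℝ, 2 ≤ x → x ≤ n + 1 + 1 → k x = x - 1 := fun x h1 h2 =>
    hk.right x h1 (by push_cast; exact h2)
  rw [e1]
  -- by equivariance `x ∈ [0, n + 2]`, and the maps are affine on `[0, 2]`, `[2, 4]`, `[4, n + 2]`
  rcases le_total x 2 with h2 | h2
  · have a1 := intertwiners_apply hh.mem (x / 2 + -1)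
    rw [hh.right _ (by push_cast; linarith) (by push_cast; linarith)] at a1
    have a2 := intertwiners_apply hk.mem (x - 2)
    rw [hkr _ (by push_cast; linarith) (by push_cast; linarith)] at a2
    push_cast at a1 a2
    have a3 : k (x - 2) + 1 + 1 = x := by linarith
    rw [hk.left x hx0 h2, a3, hh.left x hx0 h2]
    linarith
  · rw [hkr x h2 hxn]
    rcases le_total x 4 with h4 | h4
    · rw [hk.left (x - 2) (by linarith) (by linarith), hh.left _ (by linarith) (by linarith),
        hh.right _ (by linarith) (by linarith)]
      ring
    · rw [hkr (x - 2) (by linarith) (by linarith), hh.right _ (by linarith) (by linarith),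
        hh.right _ (by linarith) (by linarith)]
      ring

/-! ### Thompson's group has no abelian quotient -/

section perfect

variable {A : Type*} [CommGroup A] (χ : lifts 1 (le_refl 2) →* A)

open Classical in
/-- The extension of `χ` by `1` to all the increasing homeomorphisms of the line. -/
noncomputable def extend (g : ℝ ≃o ℝ) : A :=
  if h : g ∈ lifts 1 (le_refl 2) then χ ⟨g, h⟩ else 1

variable {χ}

theorem extend_eq {g : ℝ ≃o ℝ} (hg : g ∈ intertwiners 1 1) :
    extend χ g = χ ⟨g, mem_lifts_iff_intertwiners.2 hg⟩ := dif_pos _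

theorem extend_mul {g h : ℝ ≃o ℝ} (hg : g ∈ intertwiners 1 1) (hh : h ∈ intertwiners 1 1) :
    extend χ (g * h) = extend χ g * extend χ h := by
  rw [extend_eq hg, extend_eq hh, extend_eq (intertwiners_mul hg hh), ← map_mul]
  rfl

theorem extend_one : extend χ 1 = 1 := by
  rw [extend_eq (one_mem_intertwiners 1), ← map_one χ]
  rfl

theorem extend_inv {g : ℝ ≃o ℝ} (hg : g ∈ intertwiners 1 1) :
    extend χ g⁻¹ = (extend χ g)⁻¹ := by
  rw [eq_inv_iff_mul_eq_one, ← extend_mul (intertwiners_inv hg) hg, inv_mul_cancel, extend_one]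

variable (χ)

/-- The value of `χ` at a homeomorphism `g` of the circle of length `n`, transported by
`φ : ℝ / nℤ → ℝ / ℤ`. -/
noncomputable def transported (φ g : ℝ ≃o ℝ) : A := extend χ (φ * g * φ⁻¹)

variable {χ}

theorem conj_mem_intertwiners {n k : ℕ} {φ g : ℝ ≃o ℝ} (hφ : φ ∈ intertwiners n k)
    (hg : g ∈ intertwiners n n) : φ * g * φ⁻¹ ∈ intertwiners k k :=
  intertwiners_mul (intertwiners_mul hφ hg) (intertwiners_inv hφ)

theorem transported_mul {n : ℕ} {φ g h : ℝ ≃o ℝ} (hφ : φ ∈ intertwiners n 1)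
    (hg : g ∈ intertwiners n n) (hh : h ∈ intertwiners n n) :
    transported χ φ (g * h) = transported χ φ g * transported χ φ h := by
  rw [transported, transported, transported, ← extend_mul (conj_mem_intertwiners hφ hg)
    (conj_mem_intertwiners hφ hh)]
  refine congrArg _ ?_
  group

theorem transported_inv {n : ℕ} {φ g : ℝ ≃o ℝ} (hφ : φ ∈ intertwiners n 1)
    (hg : g ∈ intertwiners n n) : transported χ φ g⁻¹ = (transported χ φ g)⁻¹ := by
  rw [transported, transported, ← extend_inv (conj_mem_intertwiners hφ hg)]
  refine congrArg _ ?_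
  group

/-- As the target of `χ` is commutative, the transported value does not depend on `φ`. -/
theorem transported_congr {n : ℕ} {φ ψ g : ℝ ≃o ℝ} (hφ : φ ∈ intertwiners n 1)
    (hψ : ψ ∈ intertwiners n 1) (hg : g ∈ intertwiners n n) :
    transported χ φ g = transported χ ψ g := by
  have hu : φ * ψ⁻¹ ∈ intertwiners 1 1 := intertwiners_mul hφ (intertwiners_inv hψ)
  have h : φ * g * φ⁻¹ = (φ * ψ⁻¹) * (ψ * g * ψ⁻¹) * (φ * ψ⁻¹)⁻¹ := by group
  rw [transported, transported, h, extend_mul (intertwiners_mul hu (conj_mem_intertwiners hψ hg))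
    (intertwiners_inv hu), extend_mul hu (conj_mem_intertwiners hψ hg), extend_inv hu,
    mul_inv_cancel_comm]

theorem transported_conj {n k : ℕ} {φ ψ σ g : ℝ ≃o ℝ} (hφ : φ ∈ intertwiners n 1)
    (hψ : ψ ∈ intertwiners k 1) (hσ : σ ∈ intertwiners n k) (hg : g ∈ intertwiners k k) :
    transported χ φ (σ⁻¹ * g * σ) = transported χ ψ g := by
  rw [← transported_congr (intertwiners_mul hφ (intertwiners_inv hσ)) hψ hg]
  simp only [transported]
  refine congrArg _ ?_
  group

/-- A sequence of torsion elements with these properties is trivial: `t 2`, …, `t 5` vanish because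
of the orders, and then the relation gives `2 • t (n + 2) = 0` and `2 • t (n + 3) = t (n + 2)` when
`t n` and `t (n + 1)` vanish for an even `n`, and `n + 3` is odd. -/
theorem eq_zero_of_recurrence {M : Type*} [AddCommGroup M] {t : ℕ → M}
    (h1 : ∀ n, 2 ≤ n → n • t n = 0)
    (h2 : ∀ n, 2 ≤ n → t (n + 1) - t n = (2 : ℤ) • (t (n + 2) - t (n + 1))) :
    ∀ n, 2 ≤ n → t n = 0 := by
  have h1' : ∀ n : ℕ, 2 ≤ n → (n : ℤ) • t n = 0 := fun n hn => by
    rw [natCast_zsmul]; exact h1 n hn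
  have key : ∀ k : ℕ, t (2 * k + 2) = 0 ∧ t (2 * k + 3) = 0 := by
    intro k
    induction k with
    | zero =>
      have r2 := h2 2 (by norm_num)
      have r3 := h2 3 (by norm_num)
      have o3 := h1' 3 (by norm_num)
      have o4 := h1' 4 (by norm_num)
      have o5 := h1' 5 (by norm_num)
      push_cast at o3 o4 o5
      norm_num at r2 r3
      have t5 : t 5 = 0 := by
        linear_combination (norm := module) (5 : ℤ) • o5 + (12 : ℤ) • r3 + (4 : ℤ) • o3 - (9 : ℤ) • o4
      have e3 : t 3 = (3 : ℤ) • t 4 := by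
        linear_combination (norm := module) (-2 : ℤ) • t5 - r3
      have t4 : t 4 = 0 := by
        linear_combination (norm := module) o3 - (2 : ℤ) • o4 - (3 : ℤ) • e3
      have t3 : t 3 = 0 := by
        linear_combination (norm := module) e3 + (3 : ℤ) • t4
      have t2 : t 2 = 0 := by
        linear_combination (norm := module) (3 : ℤ) • t3 - (2 : ℤ) • t4 - r2
      exact ⟨t2, t3⟩
    | succ k ih =>
      obtain ⟨a, b⟩ := ih
      have r2 := h2 (2 * k + 2) (by omega)
      have r3 := h2 (2 * k + 3) (by omega)
      have o5 := h1' (2 * k + 5) (by omega)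
      have e : 2 * (k + 1) + 2 = 2 * k + 4 := by ring
      have e' : 2 * (k + 1) + 3 = 2 * k + 5 := by ring
      rw [e, e']
      norm_num [add_assoc] at r2 r3
      rw [a, b] at r2
      rw [b] at r3
      have c4 : (2 : ℤ) • t (2 * k + 4) = 0 := by simpa using r2.symm
      have c5 : t (2 * k + 4) = (2 : ℤ) • t (2 * k + 5) := by
        linear_combination (norm := module) r3 - c4
      have d5 : t (2 * k + 5) = 0 := by
        have o : ((2 * k + 5 : ℕ) : ℤ) • t (2 * k + 5) = 0 := o5
        push_cast at o
        have q4 : t (2 * k + 4) = 0 := by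
          linear_combination (norm := module) (2 : ℤ) • o - (k : ℤ) • c4 - (2 : ℤ) • c4 +
            (2 * k + 5 : ℤ) • c5
        linear_combination (norm := module) o - (k + 2 : ℤ) • q4 + (k + 2 : ℤ) • c5
      exact ⟨by rw [c5, d5, smul_zero], d5⟩
  intro n hn
  obtain ⟨k, rfl | rfl⟩ := Nat.even_or_odd' n
  · obtain ⟨j, rfl⟩ : ∃ j, k = j + 1 := ⟨k - 1, by omega⟩
    exact (key j).1
  · obtain ⟨j, rfl⟩ : ∃ j, k = j + 1 := ⟨k - 1, by omega⟩
    exact (key j).2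

theorem shift_one_mem_intertwiners (n : ℕ) : shift 1 ∈ intertwiners n n := by
  simpa using shift_mem_intertwiners n 1

theorem transported_one {φ : ℝ ≃o ℝ} : transported χ φ 1 = 1 := by
  rw [transported, mul_one, mul_inv_cancel, extend_one]

theorem transported_pow {n : ℕ} {φ g : ℝ ≃o ℝ} (hφ : φ ∈ intertwiners n 1)
    (hg : g ∈ intertwiners n n) (k : ℕ) :
    transported χ φ (g ^ k) = transported χ φ g ^ k := by
  have hpow : ∀ k, g ^ k ∈ intertwiners n n := fun k =>
    mem_lifts_iff_intertwiners.1 ((lifts n _).pow_mem (mem_lifts_iff_intertwiners.2 hg) k)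
  induction k with
  | zero => rw [pow_zero, pow_zero, transported_one]
  | succ k ih => rw [pow_succ, pow_succ, transported_mul hφ (hpow k) hg, ih]

theorem transported_shift (h1 : extend χ (shift 1) = 1) {n : ℕ} {φ : ℝ ≃o ℝ}
    (hφ : φ ∈ intertwiners n 1) : transported χ φ (shift n) = 1 := by
  rw [transported, hφ.2, mul_inv_cancel_right, Nat.cast_one, h1]

/-- The rotations of order `n` of the circles of length `n` are in the kernel of `χ`. The quotient
of the values at the rotations of orders `n + 1` and `n` is the value at the map from the
subdivision in which one interval has been halved to that in which the next one has been halved;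
such maps are related by `IsHalving.relation`. -/
theorem transported_rotation (h1 : extend χ (shift 1) = 1) {n : ℕ} (hn : 2 ≤ n) {φ : ℝ ≃o ℝ}
    (hφ : φ ∈ intertwiners n 1) : transported χ φ (shift 1) = 1 := by
  have hex : ∀ n : ℕ, ∃ φ : ℝ ≃o ℝ, 2 ≤ n → φ ∈ intertwiners n 1 := fun n => by
    by_cases h : 2 ≤ n
    · obtain ⟨φ, h⟩ := exists_intertwiner (n := n) (by omega)
      exact ⟨φ, fun _ => h⟩
    · exact ⟨1, fun h' => absurd h' h⟩
  choose ψ hψ using hex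
  set t : ℕ → A := fun n => transported χ (ψ n) (shift 1) with ht
  -- `d h` compares the halvings of the intervals `[0, 1]` and `[1, 2]`
  set d : ℝ ≃o ℝ → ℝ ≃o ℝ := fun h => shift 1 * (h⁻¹ * (shift 1)⁻¹ * h) with hd
  have hin : ∀ {n : ℕ} {h : ℝ ≃o ℝ}, IsHalving n h →
      h⁻¹ * (shift 1)⁻¹ * h ∈ intertwiners (n + 1) (n + 1) := fun {n h} hh =>
    intertwiners_mul (intertwiners_mul (intertwiners_inv hh.mem)
      (intertwiners_inv (shift_one_mem_intertwiners n))) hh.mem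
  have hdm : ∀ {n : ℕ} {h : ℝ ≃o ℝ}, IsHalving n h → d h ∈ intertwiners (n + 1) (n + 1) :=
    fun hh => intertwiners_mul (shift_one_mem_intertwiners _) (hin hh)
  have hdt : ∀ {n : ℕ} {h : ℝ ≃o ℝ}, 2 ≤ n → IsHalving n h →
      transported χ (ψ (n + 1)) (d h) = t (n + 1) * (t n)⁻¹ := by
    intro n h hn hh
    simp only [hd]
    rw [transported_mul (hψ (n + 1) (by omega)) (shift_one_mem_intertwiners _) (hin hh),
      transported_conj (hψ (n + 1) (by omega)) (hψ n hn) hh.mem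
        (intertwiners_inv (shift_one_mem_intertwiners n)),
      transported_inv (hψ n hn) (shift_one_mem_intertwiners n)]
  have hord : ∀ n, 2 ≤ n → t n ^ n = 1 := by
    intro n hn
    simp only [ht]
    rw [← transported_pow (hψ n hn) (shift_one_mem_intertwiners n), shift_pow, mul_one,
      transported_shift h1 (hψ n hn)]
  have hrec : ∀ n, 2 ≤ n → t (n + 1) * (t n)⁻¹ = (t (n + 2) * (t (n + 1))⁻¹) ^ 2 := by
    intro n hn
    obtain ⟨h, hh⟩ := exists_isHalving hn
    obtain ⟨k, hk⟩ := exists_isHalving (n := n + 1) (by omega)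
    have hψ2 := hψ (n + 2) (by omega)
    have hs := shift_one_mem_intertwiners (n + 2)
    have hrel : k⁻¹ * d h * k = shift 1 * d k * (shift 1)⁻¹ * d k := by
      have e := hh.relation hn hk
      have e1 : k⁻¹ * d h * k = (shift 1 * h * (shift 1)⁻¹ * k)⁻¹ * (h * k) := by
        simp only [hd]; group
      rw [e1, e]
      simp only [hd, mul_assoc, mul_inv_rev, inv_inv, inv_mul_cancel_left, mul_inv_cancel_left]
    have e2 : transported χ (ψ (n + 2)) (k⁻¹ * d h * k) = t (n + 1) * (t n)⁻¹ := by
      rw [transported_conj hψ2 (hψ (n + 1) (by omega)) hk.mem (hdm hh), hdt hn hh]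
    rw [hrel, transported_mul hψ2 (intertwiners_mul (intertwiners_mul hs (hdm hk))
      (intertwiners_inv hs)) (hdm hk), transported_mul hψ2 (intertwiners_mul hs (hdm hk))
      (intertwiners_inv hs), transported_mul hψ2 hs (hdm hk), transported_inv hψ2 hs,
      mul_inv_cancel_comm, hdt (by omega) hk] at e2
    rw [← e2, pow_two]
  have key := eq_zero_of_recurrence (M := Additive A) (t := fun n => Additive.ofMul (t n))
    (fun n hn => by rw [← ofMul_pow, hord n hn, ofMul_one])
    (fun n hn => by
      rw [← ofMul_div, ← ofMul_div, ← ofMul_zpow, div_eq_mul_inv, div_eq_mul_inv, hrec n hn]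
      norm_cast) n hn
  rw [transported_congr hφ (hψ n hn) (shift_one_mem_intertwiners n)]
  exact key

/-- On `[i, i + 1]` the map `φ` is affine with slope at least `2 ^ (-K)`, a power of `2`, and
`φ i` is a multiple of `2 ^ (-K)`. -/
def DyadicAt (K : ℕ) (φ : ℝ ≃o ℝ) (i : ℤ) : Prop :=
  ∃ k z : ℤ, k ≤ K ∧ φ i = z * (2 : ℝ) ^ (-K : ℤ) ∧
    ∀ x ∈ Set.Icc (i : ℝ) (i + 1), φ x = φ i + (2 : ℝ) ^ (-k) * (x - i)

theorem DyadicAt.translate {n K : ℕ} {φ : ℝ ≃o ℝ} (hφ : φ ∈ intertwiners n 1) {i : ℤ}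
    (h : DyadicAt K φ i) (j : ℤ) : DyadicAt K φ (i + j * n) := by
  obtain ⟨k, z, hk, hz, ha⟩ := h
  have e : ∀ x, φ (x + j * n) = φ x + j := fun x => by simpa using intertwiners_apply_int hφ x j
  have ei : ((i + j * n : ℤ) : ℝ) = i + j * n := by push_cast; ring
  refine ⟨k, z + j * 2 ^ K, hk, ?_, fun x hx => ?_⟩
  · rw [ei, e, hz, zpow_neg, zpow_natCast]
    push_cast
    field_simp
  · rw [ei] at hx ⊢
    have h1 := ha (x - j * n) ⟨by linarith [hx.1], by linarith [hx.2]⟩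
    have h2 := e (x - j * n)
    rw [sub_add_cancel] at h2
    rw [h2, h1, e]
    ring

theorem dyadicAt_of_range {n K : ℕ} (hn : n ≠ 0) {φ : ℝ ≃o ℝ} (hφ : φ ∈ intertwiners n 1)
    (h : ∀ i : ℤ, 0 ≤ i → i < n → DyadicAt K φ i) (i : ℤ) : DyadicAt K φ i := by
  have hn0 : (0 : ℤ) < n := by exact_mod_cast Nat.pos_of_ne_zero hn
  have := (h (i % n) (Int.emod_nonneg _ hn0.ne') (Int.emod_lt_of_pos _ hn0)).translate hφ (i / n)
  rwa [mul_comm, Int.emod_add_mul_ediv] at this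

theorem dyadicAt_mul_shift {K : ℕ} {φ : ℝ ≃o ℝ} (h : ∀ i, DyadicAt K φ i) (j i : ℤ) :
    DyadicAt K (φ * shift (j : ℝ)) i := by
  obtain ⟨k, z, hk, hz, ha⟩ := h (i + j)
  push_cast at hz ha
  refine ⟨k, z, hk, by simpa using hz, fun x hx => ?_⟩
  simp only [RelIso.mul_apply, shift_apply]
  rw [ha (x + j) ⟨by linarith [hx.1], by linarith [hx.2]⟩]
  ring

theorem zpow_neg_eq_mul {k : ℤ} {K : ℕ} (h : k ≤ K) :
    ∃ j : ℕ, (2 : ℝ) ^ (-k) = 2 ^ j * (2 : ℝ) ^ (-K : ℤ) := by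
  refine ⟨(K - k).toNat, ?_⟩
  rw [← zpow_natCast, ← zpow_add₀ (by norm_num)]
  congr 1
  omega

theorem dyadicAt_mul_halving {n K : ℕ} {φ h : ℝ ≃o ℝ} (hφ : φ ∈ intertwiners n 1)
    (hh : IsHalving n h) (hd : ∀ i, DyadicAt K φ i) {k : ℤ} (hk : k < K)
    (hφ0 : ∀ x ∈ Set.Icc (0 : ℝ) 1, φ x = φ 0 + (2 : ℝ) ^ (-k) * x) (i : ℤ) :
    DyadicAt K (φ * h) i := by
  have h00 : h 0 = 0 := by rw [hh.left 0 le_rfl (by norm_num)]; simp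
  have hhalf : (2 : ℝ) ^ (-(k + 1)) = (2 : ℝ) ^ (-k) / 2 := by
    rw [neg_add, zpow_add₀ (by norm_num)]; norm_num; ring
  obtain ⟨-, z, -, hz, -⟩ := hd 0
  rw [Int.cast_zero] at hz
  refine dyadicAt_of_range (n := n + 1) (by omega) (intertwiners_mul hφ hh.mem) ?_ i
  intro i hi0 hin
  rcases (show i = 0 ∨ i = 1 ∨ 2 ≤ i by omega) with rfl | rfl | hi2
  · refine ⟨k + 1, z, by omega, by simp [h00, hz], fun x hx => ?_⟩
    push_cast at hx
    simp only [RelIso.mul_apply, Int.cast_zero, h00]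
    rw [hh.left x hx.1 (by linarith [hx.2]),
      hφ0 (x / 2) ⟨by linarith [hx.1], by linarith [hx.2]⟩, hhalf]
    ring
  · obtain ⟨j, hj⟩ := zpow_neg_eq_mul (k := k + 1) (K := K) (by omega)
    have e1 : h 1 = 1 / 2 := hh.left 1 (by norm_num) (by norm_num)
    have e2 : φ (1 / 2) = φ 0 + (2 : ℝ) ^ (-(k + 1)) := by
      rw [hφ0 _ (by norm_num), hhalf]; ring
    refine ⟨k + 1, z + 2 ^ j, by omega, ?_, fun x hx => ?_⟩
    · simp only [RelIso.mul_apply, Int.cast_one, e1, e2]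
      rw [hj, hz]
      push_cast
      ring
    · push_cast at hx
      simp only [RelIso.mul_apply, Int.cast_one, e1, e2]
      rw [hh.left x (by linarith [hx.1]) (by linarith [hx.2]),
        hφ0 (x / 2) ⟨by linarith [hx.1], by linarith [hx.2]⟩, hhalf]
      ring
  · obtain ⟨k', z', hk', hz', ha⟩ := hd (i - 1)
    push_cast at hz' ha
    have hi2' : (2 : ℝ) ≤ i := by exact_mod_cast hi2
    have hin' : (i : ℝ) + 1 ≤ n + 1 := by exact_mod_cast hin
    have ei : h i = i - 1 := hh.right i hi2' (by linarith)
    refine ⟨k', z', hk', by simp [ei, hz'], fun x hx => ?_⟩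
    simp only [RelIso.mul_apply, ei]
    rw [hh.right x (by linarith [hx.1]) (by linarith [hx.2]),
      ha (x - 1) ⟨by linarith [hx.1], by linarith [hx.2]⟩]
    ring

/-- A subdivision of the circle into `n` dyadic intervals of lengths at least `2 ^ (-K)` is either
uniform, or `n < 2 ^ K` and one of the intervals is longer than `2 ^ (-K)`. -/
theorem dyadic_cases {n K : ℕ} {φ : ℝ ≃o ℝ} (hφ : φ ∈ intertwiners n 1)
    (hd : ∀ i, DyadicAt K φ i) :
    (n = 2 ^ K ∧ ∀ x, φ x = φ 0 + (2 : ℝ) ^ (-K : ℤ) * x) ∨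
    (n < 2 ^ K ∧ ∃ i k : ℤ, k < K ∧
      ∀ x ∈ Set.Icc (i : ℝ) (i + 1), φ x = φ i + (2 : ℝ) ^ (-k) * (x - i)) := by
  have hu : (0 : ℝ) < (2 : ℝ) ^ (-K : ℤ) := by positivity
  have huK : (2 : ℝ) ^ (-K : ℤ) * 2 ^ K = 1 := by
    rw [zpow_neg, zpow_natCast, inv_mul_cancel₀ (by positivity)]
  have hφn : ∀ x, φ (x + n) = φ x + 1 := fun x => by simpa using intertwiners_apply hφ x
  choose k z hk hz ha using hd
  have hstep : ∀ i : ℤ, φ (i + 1) = φ i + (2 : ℝ) ^ (-k i) := fun i => by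
    rw [ha i (i + 1) ⟨by linarith, le_rfl⟩]; ring
  by_cases hall : ∃ i, k i < K
  · obtain ⟨i, hi⟩ := hall
    refine Or.inr ⟨?_, i, k i, hi, ha i⟩
    -- the first of the intervals from `i` on counts at least twice
    have hmono : ∀ j : ℕ, φ i + (j + 2) * (2 : ℝ) ^ (-K : ℤ) ≤ φ ((i : ℝ) + (j + 1)) := by
      intro j
      induction j with
      | zero =>
        have h1 := hstep i
        have h2 : (2 : ℝ) ^ (-(K : ℤ) + 1) ≤ (2 : ℝ) ^ (-k i) :=
          zpow_le_zpow_right₀ (by norm_num) (by omega)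
        rw [zpow_add₀ (by norm_num), zpow_one] at h2
        simp only [Nat.cast_zero, zero_add]
        linarith
      | succ j ih =>
        have h1 := hstep (i + j + 1)
        have h2 : (2 : ℝ) ^ (-(K : ℤ)) ≤ (2 : ℝ) ^ (-k (i + j + 1)) :=
          zpow_le_zpow_right₀ (by norm_num) (by have := hk (i + j + 1); omega)
        push_cast at h1 ⊢
        rw [← add_assoc, ← add_assoc]
        rw [← add_assoc] at ih
        linarith
    have hn : n ≠ 0 := by
      rintro rfl
      have := hφn 0
      simp at this
    obtain ⟨j, rfl⟩ := Nat.exists_eq_succ_of_ne_zero hn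
    have h1 := hmono j
    have h2 := hφn i
    push_cast at h2
    rw [h2] at h1
    have h3 : ((j : ℝ) + 2) ≤ 2 ^ K := by
      have : (j + 2) * (2 : ℝ) ^ (-K : ℤ) * 2 ^ K ≤ 1 * 2 ^ K := by
        gcongr; linarith
      rwa [mul_assoc, huK, mul_one, one_mul] at this
    have h4 : j + 2 ≤ 2 ^ K := by exact_mod_cast h3
    omega
  · have hall' : ∀ i, k i = K := fun i => by
      by_contra h
      exact hall ⟨i, lt_of_le_of_ne (hk i) h⟩
    have hint : ∀ i : ℤ, φ i = φ 0 + (2 : ℝ) ^ (-K : ℤ) * i := by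
      intro i
      induction i with
      | zero => simp
      | succ j ih =>
        have := hstep j
        rw [hall', ih] at this
        push_cast at this ⊢
        rw [this]
        ring
      | pred j ih =>
        have := hstep (-j - 1)
        push_cast at this ih ⊢
        rw [hall', sub_add_cancel, ih] at this
        linarith
    refine Or.inl ⟨?_, fun x => ?_⟩
    · have h1 := hint n
      have h2 := hφn 0
      rw [zero_add] at h2
      rw [Int.cast_natCast, h2] at h1
      have h3 : (n : ℝ) = 2 ^ K := by
        have : (1 : ℝ) = (2 : ℝ) ^ (-K : ℤ) * n := by linarith
        calc (n : ℝ) = (2 : ℝ) ^ (-K : ℤ) * 2 ^ K * n := by rw [huK, one_mul]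
          _ = (2 : ℝ) ^ (-K : ℤ) * n * 2 ^ K := by ring
          _ = 2 ^ K := by rw [← this, one_mul]
      exact_mod_cast h3
    · rw [ha ⌊x⌋ x ⟨Int.floor_le x, (Int.lt_floor_add_one x).le⟩, hint, hall']
      ring

theorem extend_mul_inv_trans {n : ℕ} {φ ψ ρ : ℝ ≃o ℝ} (hφ : φ ∈ intertwiners n 1)
    (hψ : ψ ∈ intertwiners n 1) (hρ : ρ ∈ intertwiners n 1) :
    extend χ (φ * ρ⁻¹) = extend χ (φ * ψ⁻¹) * extend χ (ψ * ρ⁻¹) := by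
  rw [← extend_mul (intertwiners_mul hφ (intertwiners_inv hψ))
    (intertwiners_mul hψ (intertwiners_inv hρ))]
  refine congrArg _ ?_
  group

theorem extend_mul_shift_mul_inv (h1 : extend χ (shift 1) = 1) {n : ℕ} (hn : 2 ≤ n)
    {φ : ℝ ≃o ℝ} (hφ : φ ∈ intertwiners n 1) (j : ℤ) :
    extend χ (φ * shift (j : ℝ) * φ⁻¹) = 1 := by
  have key : ∀ k : ℕ, transported χ φ (shift (k : ℝ)) = 1 := fun k => by
    have := transported_pow (χ := χ) hφ (shift_one_mem_intertwiners n) k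
    rwa [shift_pow, mul_one, transported_rotation h1 hn hφ, one_pow] at this
  obtain ⟨k, rfl | rfl⟩ := j.eq_nat_or_neg
  · exact key k
  · have := transported_inv (χ := χ) hφ (shift_mem_intertwiners n k)
    rw [Int.cast_natCast, key, shift_inv, inv_one] at this
    push_cast
    exact this

/-- A map between two subdivisions into `n` dyadic intervals is in the kernel of `χ`: halving an
interval of each of them multiplies it by an element of the kernel, and repeated halving makes both
subdivisions uniform. -/
theorem extend_dyadic (h1 : extend χ (shift 1) = 1) (K : ℕ) (d : ℕ) :
    ∀ {n : ℕ} {φ ψ : ℝ ≃o ℝ}, 2 ≤ n → 2 ^ K ≤ n + d → φ ∈ intertwiners n 1 →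
      ψ ∈ intertwiners n 1 → (∀ i, DyadicAt K φ i) → (∀ i, DyadicAt K ψ i) →
      extend χ (φ * ψ⁻¹) = 1 := by
  have hunif : ∀ {n : ℕ} {φ ψ : ℝ ≃o ℝ}, 2 ≤ n → φ ∈ intertwiners n 1 →
      ψ ∈ intertwiners n 1 → (∀ i, DyadicAt K φ i) → (∀ i, DyadicAt K ψ i) → 2 ^ K ≤ n →
      extend χ (φ * ψ⁻¹) = 1 := by
    intro n φ ψ hn hφ hψ hdφ hdψ hK
    rcases dyadic_cases hφ hdφ with ⟨-, e⟩ | ⟨hlt, -⟩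
    swap
    · omega
    rcases dyadic_cases hψ hdψ with ⟨-, e'⟩ | ⟨hlt, -⟩
    swap
    · omega
    obtain ⟨-, z, -, hz, -⟩ := hdφ 0
    obtain ⟨-, z', -, hz', -⟩ := hdψ 0
    rw [Int.cast_zero] at hz hz'
    have : φ = ψ * shift ((z - z' : ℤ) : ℝ) := by
      ext x
      rw [RelIso.mul_apply, shift_apply, e, e', hz, hz']
      push_cast
      ring
    rw [this]
    exact extend_mul_shift_mul_inv h1 hn hψ _
  induction d with
  | zero => exact fun hn hK hφ hψ hdφ hdψ => hunif hn hφ hψ hdφ hdψ hK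
  | succ d ih =>
    intro n φ ψ hn hK hφ hψ hdφ hdψ
    rcases dyadic_cases hφ hdφ with ⟨e, -⟩ | ⟨hlt, i, k, hk, hi⟩
    · exact hunif hn hφ hψ hdφ hdψ e.ge
    rcases dyadic_cases hψ hdψ with ⟨e, -⟩ | ⟨-, i', k', hk', hi'⟩
    · exact hunif hn hφ hψ hdφ hdψ e.ge
    obtain ⟨h, hh⟩ := exists_isHalving hn
    have hφs := intertwiners_mul hφ (shift_mem_intertwiners n i)
    have hψs := intertwiners_mul hψ (shift_mem_intertwiners n i')
    -- relabel so that the intervals to be halved are both number `0`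
    have key := ih (n := n + 1) (by omega) (by omega) (intertwiners_mul hφs hh.mem)
      (intertwiners_mul hψs hh.mem)
      (dyadicAt_mul_halving hφs hh (dyadicAt_mul_shift hdφ i) hk fun x hx => by
        simp only [RelIso.mul_apply, shift_apply, zero_add]
        rw [hi _ ⟨by linarith [hx.1], by linarith [hx.2]⟩]
        ring)
      (dyadicAt_mul_halving hψs hh (dyadicAt_mul_shift hdψ i') hk' fun x hx => by
        simp only [RelIso.mul_apply, shift_apply, zero_add]
        rw [hi' _ ⟨by linarith [hx.1], by linarith [hx.2]⟩]
        ring)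
    have e : φ * shift (i : ℝ) * h * (ψ * shift (i' : ℝ) * h)⁻¹ =
        φ * shift (i : ℝ) * (ψ * shift (i' : ℝ))⁻¹ := by group
    rw [e, extend_mul_inv_trans hφs hφ hψs, extend_mul_inv_trans hφ hψ hψs,
      extend_mul_shift_mul_inv h1 hn hφ, one_mul] at key
    have e2 : extend χ (ψ * (ψ * shift (i' : ℝ))⁻¹) = 1 := by
      have := extend_inv (χ := χ) (conj_mem_intertwiners hψ (shift_mem_intertwiners n i'))
      rw [extend_mul_shift_mul_inv h1 hn hψ, inv_one] at this
      rw [← this]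
      refine congrArg _ ?_
      group
    rwa [e2, mul_one] at key

/-- Every lift `f` of an element of `T` maps the uniform subdivision of the circle into `2 ^ K`
intervals to a subdivision into dyadic intervals, for `K` large. -/
theorem exists_dyadic {f : ℝ ≃o ℝ} (hf : f ∈ intertwiners 1 1) :
    ∃ (n K : ℕ) (φ : ℝ ≃o ℝ), 2 ≤ n ∧ φ ∈ intertwiners n 1 ∧ (∀ i, DyadicAt K φ i) ∧
      ∀ i, DyadicAt K (f * φ) i := by
  obtain ⟨hf1, P, hP, hPf, hPa⟩ := hf.1
  have hden : ∀ x : ℝ, ∃ K : ℕ, x ∈ mAdic 2 → ∀ k ≥ K, ∃ N : ℤ, x = N / (2 : ℝ) ^ k := fun x => by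
    by_cases hx : x ∈ mAdic 2
    · obtain ⟨K, hK⟩ := exists_common_denominator le_rfl hx
      exact ⟨K, fun _ => by exact_mod_cast hK⟩
    · exact ⟨0, fun h => absurd h hx⟩
  choose D hD using hden
  obtain ⟨L, hL⟩ : ∃ L, L = ((hPf 0 1).toFinset.sup D) + 1 := ⟨_, rfl⟩
  set n := 2 ^ L with hn
  have hn0 : (0 : ℝ) < (2 : ℝ) ^ L := by positivity
  have hn2 : 2 ≤ n := by
    rw [hn, hL, pow_succ]
    have : 1 ≤ 2 ^ ((hPf 0 1).toFinset.sup D) := Nat.one_le_two_pow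
    omega
  set φ := affineIso (le_refl 2) (-L : ℤ) 0 with hφdef
  have hφx : ∀ x, φ x = x / 2 ^ L := fun x => by
    rw [hφdef, affineIso_apply, Nat.cast_ofNat, zpow_neg, zpow_natCast]
    field_simp
    simp
  have hφ : φ ∈ intertwiners n 1 := by
    refine ⟨affineIso_mem le_rfl _ mAdic_zero, ?_⟩
    ext x
    simp only [RelIso.mul_apply, shift_apply, hφx, hn]
    push_cast
    field_simp
  have hpiece : ∀ i : ℤ, ∃ K₀ : ℕ, 0 ≤ i → i < n → ∀ K ≥ K₀, DyadicAt K (f * φ) i := by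
    intro i
    by_cases hi : 0 ≤ i ∧ i < n
    swap
    · exact ⟨0, fun h h' => absurd ⟨h, h'⟩ hi⟩
    have hi0 : (0 : ℝ) ≤ i := by exact_mod_cast hi.1
    have hi1 : (i : ℝ) + 1 ≤ 2 ^ L := by exact_mod_cast hi.2
    obtain ⟨s, β, hs⟩ := hPa (i / 2 ^ L) ((i + 1) / 2 ^ L) (by gcongr; linarith) (by
      rintro c hc ⟨h2, h3⟩
      have hc01 : c ∈ (hPf 0 1).toFinset := by
        rw [Set.Finite.mem_toFinset]
        refine ⟨hc, le_trans (by positivity) h2.le, h3.le.trans ?_⟩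
        rw [div_le_one hn0]
        exact hi1
      obtain ⟨N, hN⟩ := hD c (hP hc) L (hL ▸ (Finset.le_sup hc01).trans (Nat.le_succ _))
      rw [hN, div_lt_div_iff_of_pos_right hn0] at h2 h3
      have h4 : i < N := by exact_mod_cast h2
      have h5 : N < i + 1 := by exact_mod_cast h3
      omega)
    have hfi : f (i / 2 ^ L) ∈ mAdic 2 := (hf1 _).2 ⟨i, -L, by
      rw [Nat.cast_ofNat, zpow_neg, zpow_natCast]; rfl⟩
    refine ⟨max (L - s).toNat (D (f (i / 2 ^ L))), fun _ _ K hK => ?_⟩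
    obtain ⟨z, hz⟩ := hD _ hfi K ((le_max_right _ _).trans hK)
    have hK' : (L - s).toNat ≤ K := (le_max_left _ _).trans hK
    refine ⟨L - s, z, by omega, ?_, fun x hx => ?_⟩
    · rw [RelIso.mul_apply, hφx, hz, zpow_neg, zpow_natCast]
      rfl
    · rw [RelIso.mul_apply, RelIso.mul_apply, hφx, hφx,
        hs (x / 2 ^ L) ⟨by gcongr; exact hx.1, by gcongr; exact hx.2⟩,
        hs (i / 2 ^ L) ⟨le_rfl, by gcongr; linarith⟩, neg_sub, zpow_sub₀ (by norm_num),
        zpow_natCast]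
      push_cast
      ring
  choose K₀ hK₀ using hpiece
  set K := max L ((Finset.Ico (0 : ℤ) n).sup K₀) with hK
  refine ⟨n, K, φ, hn2, hφ, fun i => ?_, fun i => ?_⟩
  · refine ⟨L, i * 2 ^ (K - L), by rw [hK]; exact_mod_cast le_max_left _ _, ?_, fun x _ => ?_⟩
    · have e : K = (K - L) + L := by have := le_max_left L ((Finset.Ico (0 : ℤ) n).sup K₀); omega
      rw [hφx, zpow_neg, zpow_natCast]
      nth_rw 2 [e]
      rw [pow_add]
      push_cast
      field_simp
    · rw [hφx, hφx, zpow_neg, zpow_natCast]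
      ring
  · refine dyadicAt_of_range (by omega) (intertwiners_mul hf hφ) (fun i h0 h2 => ?_) i
    exact hK₀ i h0 h2 K ((Finset.le_sup (Finset.mem_Ico.2 ⟨h0, h2⟩)).trans (le_max_right _ _))

/-- A homomorphism from `T` to a commutative group, given as a homomorphism on the group of lifts
which kills the translation by `1`, is trivial. -/
theorem eq_one_of_commGroup (h1 : χ ⟨shift ((1 : ℕ) : ℝ), shift_mem_lifts⟩ = 1) : χ = 1 := by
  have h1' : extend χ (shift 1) = 1 := by
    rw [extend_eq (shift_one_mem_intertwiners 1), ← h1]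
    congr 2
    simp
  ext ⟨f, hf⟩
  have hf' := mem_lifts_iff_intertwiners.1 hf
  obtain ⟨n, K, φ, hn, hφ, hd, hfd⟩ := exists_dyadic hf'
  have := extend_dyadic h1' K (2 ^ K) hn (by omega) (intertwiners_mul hf' hφ) hφ hfd hd
  rw [mul_inv_cancel_right, extend_eq hf'] at this
  exact this

end perfect

/-! ### Normal subgroups of Thompson's group which contain an element of finite order -/

/-- A `k`-th root of the translation by `1` can be prescribed at one point. -/
theorem exists_root_map {k : ℕ} (hk : 2 ≤ k) {b c : ℝ} (hb : b ∈ mAdic 2) (hc : c ∈ mAdic 2)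
    (hbc : b < c) (hcb : c < b + 1) :
    ∃ F : lifts 1 (le_refl 2), F.1 ^ k = shift ((1 : ℕ) : ℝ) ∧ F.1 b = c := by
  have hk' : (2 : ℝ) ≤ k := by exact_mod_cast hk
  have h1m : (1 : ℝ) ∈ mAdic 2 := by simpa using natCast_mem_mAdic (m := 2) 1
  have hkm := natCast_mem_mAdic (m := 2) k
  have hb1 := mAdic_add le_rfl hb h1m
  have two : 2 ≤ 2 := le_rfl
  obtain ⟨H₁, hH₁, a1, a2⟩ := exists_interval_map two mAdic_zero h1m hb hc one_pos hbc
    (mem_lenIdeal_two (mAdic_sub two (mAdic_sub two h1m mAdic_zero) (mAdic_sub two hc hb)))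
  obtain ⟨H₂, hH₂, b1, b2⟩ := exists_interval_map two h1m hkm hc hb1 (by linarith) hcb
    (mem_lenIdeal_two (mAdic_sub two (mAdic_sub two hkm h1m) (mAdic_sub two hb1 hc)))
  obtain ⟨H, hH, h1, h2⟩ := exists_glue two hH₁ hH₂ h1m (by rw [a2, b1])
  obtain ⟨Ψ, hΨ, hΨH, h⟩ := exists_equivariant two (shift_mem_PL two (natCast_mem_mAdic 1)) hH
    (by simp) (pow_one _) (l := k) (by linarith) hkm
    (by rw [h2 k (by linarith), h1 0 zero_le_one, a1, b2]; simp)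
  obtain ⟨h3, h4⟩ := conj_shift_mem (q := k) hΨ h1m (by rwa [mul_one])
  refine ⟨⟨_, h3⟩, h4, ?_⟩
  have e0 : Ψ 0 = b := by rw [hΨH 0 ⟨le_rfl, by linarith⟩, h1 0 zero_le_one, a1]
  have e1 : Ψ 1 = c := by rw [hΨH 1 ⟨zero_le_one, by linarith⟩, h1 1 le_rfl, a2]
  have e2 : Ψ⁻¹ b = 0 := by rw [← e0]; simp
  simp [e1, e2]

/-- The lifts of elements of `T` which are the identity near `0`. -/
def germTrivial : Subgroup (lifts 1 (le_refl 2)) where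
  carrier := {f | ∀ᶠ x in 𝓝 (0 : ℝ), f.1 x = x}
  one_mem' := Eventually.of_forall fun _ => rfl
  mul_mem' := by
    intro f g hf hg
    filter_upwards [hf, hg] with x hx hx'
    rw [Subgroup.coe_mul, RelIso.mul_apply, hx', hx]
  inv_mem' := by
    intro f hf
    filter_upwards [hf] with x hx
    rw [Subgroup.coe_inv]
    nth_rw 1 [← hx]
    simp

theorem exists_germ {f : ℝ ≃o ℝ} (hf : f ∈ PL (le_refl 2)) (h0 : f 0 = 0) :
    ∃ s t : ℤ, ∀ᶠ x in 𝓝 (0 : ℝ), f x = if 0 ≤ x then (2 : ℝ) ^ s * x else (2 : ℝ) ^ t * x := by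
  obtain ⟨-, P, -, hPf, hPa⟩ := hf
  have hfin : ((P ∩ Set.Icc (-1) 1) \ {0}).Finite := (hPf _ _).subset Set.sdiff_subset
  have hnhds : ((P ∩ Set.Icc (-1) 1) \ {0})ᶜ ∈ 𝓝 (0 : ℝ) :=
    hfin.isClosed.isOpen_compl.mem_nhds (by simp)
  obtain ⟨ε, hε, hball⟩ := Metric.mem_nhds_iff.1 hnhds
  set δ := min ε 1 with hδ
  have hδ0 : 0 < δ := lt_min hε one_pos
  have key : ∀ c ∈ P, |c| < δ → c = 0 := by
    intro c hc hcδ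
    by_contra hc0
    have h1 : c ∈ Metric.ball (0 : ℝ) ε := by
      rw [Metric.mem_ball, Real.dist_eq, sub_zero]
      exact hcδ.trans_le (min_le_left _ _)
    exact hball h1 ⟨⟨hc, abs_le.1 (hcδ.le.trans (min_le_right _ _))⟩, hc0⟩
  obtain ⟨s, β, hs⟩ := hPa 0 δ hδ0 (by
    rintro c hc ⟨h1, h2⟩
    exact h1.ne' (key c hc (by rwa [abs_of_pos h1])))
  obtain ⟨t, γ, ht⟩ := hPa (-δ) 0 (by linarith) (by
    rintro c hc ⟨h1, h2⟩
    exact h2.ne (key c hc (by rw [abs_of_neg h2]; linarith)))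
  have hβ := hs 0 ⟨le_rfl, hδ0.le⟩
  have hγ := ht 0 ⟨by linarith, le_rfl⟩
  rw [h0, mul_zero, zero_add] at hβ hγ
  refine ⟨s, t, ?_⟩
  filter_upwards [Icc_mem_nhds (neg_lt_zero.2 hδ0) hδ0] with x hx
  split_ifs with h
  · rw [hs x ⟨h, hx.2⟩, ← hβ, add_zero]; norm_num
  · rw [ht x ⟨hx.1, (not_le.1 h).le⟩, ← hγ, add_zero]; norm_num

/-- The germs at a fixed point of two piecewise affine homeomorphisms commute. -/
theorem commutator_mem_germTrivial {f g : lifts 1 (le_refl 2)} (hf : f.1 0 = 0)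
    (hg : g.1 0 = 0) : f * g * f⁻¹ * g⁻¹ ∈ germTrivial := by
  obtain ⟨s, t, hst⟩ := exists_germ (mem_lifts.1 f.2).1 hf
  obtain ⟨s', t', hst'⟩ := exists_germ (mem_lifts.1 g.2).1 hg
  have tend : ∀ e : ℝ ≃o ℝ, e 0 = 0 → Tendsto e (𝓝 0) (𝓝 0) := fun e he => by
    have := e.continuous.tendsto 0
    rwa [he] at this
  have hpos : ∀ e : ℝ ≃o ℝ, e 0 = 0 → ∀ x, 0 ≤ e x ↔ 0 ≤ x := fun e he x => by
    have := e.le_iff_le (x := 0) (y := x)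
    rwa [he] at this
  have hcomm : ∀ᶠ x in 𝓝 (0 : ℝ), f.1 (g.1 x) = g.1 (f.1 x) := by
    filter_upwards [hst, hst', (tend _ hf).eventually hst', (tend _ hg).eventually hst]
      with x h1 h2 h3 h4
    rw [h3, h4]
    simp only [hpos _ hf, hpos _ hg]
    rw [h1, h2]
    split_ifs <;> ring
  have hfg : (g.1 * f.1)⁻¹ 0 = 0 := by
    have : (g.1 * f.1) 0 = 0 := by rw [RelIso.mul_apply, hf, hg]
    nth_rw 1 [← this]
    simp
  change ∀ᶠ x in 𝓝 (0 : ℝ), (f * g * f⁻¹ * g⁻¹).1 x = x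
  filter_upwards [(tend _ hfg).eventually hcomm] with x hx
  have e : (f * g * f⁻¹ * g⁻¹).1 = f.1 * g.1 * (g.1 * f.1)⁻¹ := by
    simp only [Subgroup.coe_mul, Subgroup.coe_inv]
    group
  rw [e, RelIso.mul_apply, RelIso.mul_apply, hx, ← RelIso.mul_apply, RelIso.apply_inv_self]

section normal

variable {N : Subgroup (lifts 1 (le_refl 2))} [N.Normal] {k : ℕ}

theorem root_mem_of_root_mem {E : lifts 1 (le_refl 2)} (hE : E.1 ^ k = shift ((1 : ℕ) : ℝ))
    (hEN : E ∈ N) {F : lifts 1 (le_refl 2)} (hF : F.1 ^ k = shift ((1 : ℕ) : ℝ)) : F ∈ N := by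
  obtain ⟨Q, rfl⟩ := exists_conj_of_roots_two le_rfl hE hF
  exact Subgroup.Normal.conj_mem inferInstance E hEN Q

/-- Modulo `N`, every element is represented by one which fixes `0`. -/
theorem exists_fixing_mod (hk : 2 ≤ k)
    (hN : ∀ F : lifts 1 (le_refl 2), F.1 ^ k = shift ((1 : ℕ) : ℝ) → F ∈ N)
    (hz : (⟨shift ((1 : ℕ) : ℝ), shift_mem_lifts⟩ : lifts 1 (le_refl 2)) ∈ N)
    (f : lifts 1 (le_refl 2)) : ∃ h : lifts 1 (le_refl 2), h.1 0 = 0 ∧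
      (h : lifts 1 (le_refl 2) ⧸ N) = f := by
  set z : lifts 1 (le_refl 2) := ⟨shift ((1 : ℕ) : ℝ), shift_mem_lifts⟩ with hzdef
  have hzj : ∀ j : ℤ, (z ^ j).1 0 = j := fun j => by
    rw [Subgroup.coe_zpow, shift_zpow]; simp
  obtain ⟨g, hg, hgf⟩ : ∃ g ∈ N, g.1 0 = f.1 0 := by
    have h1 := Int.floor_le (f.1 0)
    have h2 := Int.lt_floor_add_one (f.1 0)
    rcases h1.eq_or_lt with h1 | h1
    · exact ⟨z ^ ⌊f.1 0⌋, N.zpow_mem hz _, by rw [hzj, h1]⟩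
    · obtain ⟨F, hF, hF0⟩ := exists_root_map hk (mAdic_int _) (lifts_mAdic f.2 mAdic_zero) h1 h2
      refine ⟨F * z ^ ⌊f.1 0⌋, N.mul_mem (hN F hF) (N.zpow_mem hz _), ?_⟩
      rw [Subgroup.coe_mul, RelIso.mul_apply, hzj, hF0]
  refine ⟨g⁻¹ * f, ?_, ?_⟩
  · rw [Subgroup.coe_mul, RelIso.mul_apply, ← hgf, Subgroup.coe_inv, RelIso.inv_apply_self]
  · rw [QuotientGroup.mk_mul, QuotientGroup.mk_inv, (QuotientGroup.eq_one_iff g).2 hg, inv_one,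
      one_mul]

/-- Elements which are the identity near `0` commute modulo `N`: the group `N` contains an element
which moves the support of the first one into a neighbourhood of `0` where the second one is the
identity. -/
theorem commute_of_germTrivial (hk : 2 ≤ k)
    (hN : ∀ F : lifts 1 (le_refl 2), F.1 ^ k = shift ((1 : ℕ) : ℝ) → F ∈ N)
    {f g : lifts 1 (le_refl 2)} (hf : f ∈ germTrivial) (hg : g ∈ germTrivial) :
    Commute (f : lifts 1 (le_refl 2) ⧸ N) (g : lifts 1 (le_refl 2) ⧸ N) := by
  obtain ⟨a, ham, ha0, ha1, hfa, hga⟩ : ∃ a ∈ mAdic 2, 0 < a ∧ a < 1 / 2 ∧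
      (∀ x, |x| ≤ a → f.1 x = x) ∧ ∀ x, |x| ≤ a → g.1 x = x := by
    obtain ⟨ε, hε, h⟩ := Metric.eventually_nhds_iff.1 (Filter.Eventually.and hf hg)
    obtain ⟨n, hn⟩ := exists_pow_lt_of_lt_one (lt_min hε (by norm_num : (0 : ℝ) < 1 / 2))
      (by norm_num : (1 / 2 : ℝ) < 1)
    have h' : ∀ x : ℝ, |x| ≤ (1 / 2) ^ n → f.1 x = x ∧ g.1 x = x := fun x hx => h (by
      rw [Real.dist_eq, sub_zero]
      exact (hx.trans_lt hn).trans_le (min_le_left _ _))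
    exact ⟨(1 / 2) ^ n, ⟨1, -n, by simp⟩, by positivity, hn.trans_le (min_le_right _ _),
      fun x hx => (h' x hx).1, fun x hx => (h' x hx).2⟩
  have h1m : (1 : ℝ) ∈ mAdic 2 := by simpa using natCast_mem_mAdic (m := 2) 1
  obtain ⟨F, hF, hFa⟩ := exists_root_map hk ham (mAdic_sub le_rfl h1m ham) (by linarith)
    (by linarith)
  have hper : ∀ (e : lifts 1 (le_refl 2)) (x : ℝ) (j : ℤ), e.1 (x + j) = e.1 x + j :=
    fun e x j => by
      simpa using intertwiners_apply_int (mem_lifts_iff_intertwiners.1 e.2) x j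
  have hlt : ∀ x, x < F.1 x := lt_of_pow_eq_shift (by simp) hF
  -- `F` maps `[a, 1 - a]` into `[1 - a, 1 + a]`, because `F ^ 2 ≤ F ^ k`
  have hFa' : F.1 (1 - a) ≤ 1 + a := by
    have h1 := (zpow_strictMono hlt a).monotone (show (2 : ℤ) ≤ (k : ℤ) by exact_mod_cast hk)
    simp only [zpow_natCast, hF, shift_apply] at h1
    have h2 : (F.1 ^ (2 : ℤ)) a = F.1 (F.1 a) := rfl
    rw [h2, hFa] at h1
    push_cast at h1
    linarith
  set h := F * f * F⁻¹ with hh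
  -- `S` is the set of points near an integer: `g` is the identity on it and `h` off it
  set S : Set ℝ := {x | ∃ j : ℤ, |x - j| ≤ a} with hS
  have hgS : ∀ x ∈ S, g.1 x = x := by
    rintro x ⟨j, hj⟩
    have h1 := hper g (x - j) j
    rw [hga _ hj, sub_add_cancel] at h1
    exact h1
  have hhS : ∀ x, x ∉ S → h.1 x = x := by
    intro x hx
    obtain ⟨y, rfl⟩ : ∃ y, x = F.1 y := ⟨F.1⁻¹ x, by simp⟩
    have h1 : h.1 (F.1 y) = F.1 (f.1 y) := by simp [hh]
    rw [h1]
    congr 1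
    obtain ⟨j, hj1, hj2⟩ := exists_shift le_rfl (y + a)
    rw [Nat.cast_one, mul_one] at hj1 hj2
    have h2 := hper f (y + j) (-j)
    have e : y + j + ((-j : ℤ) : ℝ) = y := by push_cast; ring
    by_cases hya : y + j ≤ a
    · rw [hfa _ (abs_le.2 ⟨by linarith, hya⟩), e] at h2
      exact h2
    · refine absurd ⟨1 - j, ?_⟩ hx
      have h3 := hper F y j
      have h4 := F.1.monotone (not_le.1 hya).le
      have h5 := F.1.monotone (show y + j ≤ 1 - a by linarith)
      rw [h3, hFa] at h4
      rw [h3] at h5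
      push_cast
      rw [abs_le]
      constructor <;> linarith
  have hcomm : h * g = g * h := by
    refine Subtype.ext (RelIso.ext fun x => ?_)
    simp only [Subgroup.coe_mul, RelIso.mul_apply]
    by_cases hx : x ∈ S
    · rw [hgS x hx, hgS (h.1 x)]
      by_contra hx'
      have := h.1.injective (hhS _ hx')
      rw [this] at hx'
      exact hx' hx
    · rw [hhS x hx, hhS (g.1 x)]
      intro hx'
      have := g.1.injective (hgS _ hx')
      rw [this] at hx'
      exact hx hx'
  have hq : (h : lifts 1 (le_refl 2) ⧸ N) = f := by
    rw [hh, QuotientGroup.mk_mul, QuotientGroup.mk_mul, QuotientGroup.mk_inv,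
      (QuotientGroup.eq_one_iff F).2 (hN F hF), inv_one, one_mul, mul_one]
  rw [← hq]
  exact congrArg (QuotientGroup.mk' N) hcomm

/-- A normal subgroup of `T` which contains an element of order `k ≥ 2` and rotation number `1 / k`
is `T`, stated for the preimages in the group of lifts: the quotient is metabelian and perfect. -/
theorem normal_eq_top (hk : 2 ≤ k) {E : lifts 1 (le_refl 2)}
    (hE : E.1 ^ k = shift ((1 : ℕ) : ℝ)) (hEN : E ∈ N)
    (hz : (⟨shift ((1 : ℕ) : ℝ), shift_mem_lifts⟩ : lifts 1 (le_refl 2)) ∈ N) : N = ⊤ := by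
  have hN : ∀ F : lifts 1 (le_refl 2), F.1 ^ k = shift ((1 : ℕ) : ℝ) → F ∈ N :=
    fun F hF => root_mem_of_root_mem hE hEN hF
  have hperf : commutator (lifts 1 (le_refl 2) ⧸ N) = ⊤ := by
    have h1 : (Abelianization.of.comp (QuotientGroup.mk' N)) = 1 :=
      eq_one_of_commGroup (by
        rw [MonoidHom.comp_apply, QuotientGroup.mk'_apply, (QuotientGroup.eq_one_iff _).2 hz,
          map_one])
    rw [← Abelianization.ker_of, eq_top_iff]
    rintro q -
    obtain ⟨f, rfl⟩ := QuotientGroup.mk_surjective q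
    exact DFunLike.congr_fun h1 f
  have hle : commutator (lifts 1 (le_refl 2) ⧸ N) ≤ germTrivial.map (QuotientGroup.mk' N) := by
    rw [commutator_def, Subgroup.commutator_le]
    rintro a - b -
    obtain ⟨f, rfl⟩ := QuotientGroup.mk_surjective a
    obtain ⟨g, rfl⟩ := QuotientGroup.mk_surjective b
    obtain ⟨f', hf', e⟩ := exists_fixing_mod hk hN hz f
    obtain ⟨g', hg', e'⟩ := exists_fixing_mod hk hN hz g
    rw [← e, ← e']
    exact ⟨f' * g' * f'⁻¹ * g'⁻¹, commutator_mem_germTrivial hf' hg', rfl⟩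
  have hbot : commutator (lifts 1 (le_refl 2) ⧸ N) ≤ ⊥ := by
    rw [commutator_def, Subgroup.commutator_le]
    rintro a - b -
    obtain ⟨f, hf, rfl⟩ := hle (hperf ▸ Subgroup.mem_top a)
    obtain ⟨g, hg, rfl⟩ := hle (hperf ▸ Subgroup.mem_top b)
    rw [Subgroup.mem_bot, commutatorElement_eq_one_iff_commute]
    exact commute_of_germTrivial hk hN hf hg
  rw [hperf] at hbot
  rw [eq_top_iff]
  intro f _
  rw [← QuotientGroup.eq_one_iff]
  exact Subgroup.mem_bot.1 (hbot (Subgroup.mem_top _))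

end normal

/-- If `m - 1` does not divide `r`, then `T_{r,m}` has no element of order `m - 1`, so that a
homomorphism from `T` to `T_{r,m}` kills a non-trivial power of an element of order `m - 1`. -/
theorem eq_one_of_not_dvd {r m : ℕ} (hr : 1 ≤ r) (hm : 2 ≤ m) (h : ¬ m - 1 ∣ r)
    (φ : ThompsonT →* BrownThompsonT r m hr hm) : φ = 1 := by
  obtain ⟨E, hE⟩ := exists_root_two le_rfl (q := m - 1) (by omega)
  set γ := toT le_rfl le_rfl E with hγ
  have hγq : γ ^ (m - 1) = 1 := finOrder_of_root le_rfl le_rfl hE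
  obtain ⟨k, hk⟩ : orderOf (φ γ) ∣ m - 1 :=
    orderOf_dvd_of_pow_eq_one (by rw [← map_pow, hγq, map_one])
  have hk2 : 2 ≤ k := by
    by_contra! hk2
    have hk1 : k = 1 := by
      rcases (show k = 0 ∨ k = 1 by omega) with rfl | rfl
      · omega
      · rfl
    rw [hk1, mul_one] at hk
    obtain ⟨F, -, hF, -⟩ := exists_root_of_orderOf hr hm (by omega) hk.symm
    exact h (dvd_of_root hF)
  set Φ := φ.comp (toT le_rfl (le_refl 2)) with hΦ
  have htop : Φ.ker = ⊤ := by
    refine normal_eq_top hk2 (E := E ^ orderOf (φ γ)) ?_ ?_ ?_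
    · rw [Subgroup.coe_pow, ← pow_mul, ← hk, hE]
    · rw [MonoidHom.mem_ker, map_pow]
      exact pow_orderOf_eq_one _
    · rw [MonoidHom.mem_ker, hΦ, MonoidHom.comp_apply,
        (toT_eq_one_iff le_rfl le_rfl).2 ⟨1, by simp⟩, map_one]
  ext1 f
  obtain ⟨F, rfl⟩ := toT_surjective le_rfl le_rfl f
  have : F ∈ Φ.ker := htop ▸ Subgroup.mem_top F
  exact this

end BrownThompson

open BrownThompson in
theorem mainTheorem2 (r m : ℕ) (hr : 1 ≤ r) (hm : 2 ≤ m) :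
    ((∀ θ : ℚ, ∃! C : ConjClasses (BrownThompsonT r m hr hm), ∀ f ∈ C.carrier,
        IsOfFinOrder f ∧ HasRotationNumber f.1 ((θ : ℝ) : AddCircle (1 : ℝ))) ↔ m = 2) ∧
    (m ≠ 2 → IsEmpty (ThompsonT ≃* BrownThompsonT r m hr hm)) ∧
    (m ≠ 2 → ¬ r ≡ 0 [MOD (m - 1)] →
      ∀ φ : ThompsonT →* BrownThompsonT r m hr hm, φ = 1) := by
  refine ⟨⟨eq_two_of_existsUnique hr hm, ?_⟩, isEmpty_mulEquiv hr hm, fun _ h => ?_⟩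
  · rintro rfl
    exact existsUnique_conjClass_two hr
  · exact eq_one_of_not_dvd hr hm fun hd => h (Nat.modEq_zero_iff_dvd.2 hd)
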